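/- Let $G=(V,E)$ be a finite, undirected, simple, loop-free graph. A perfect $m$-coloring of $G$ with color adjacency matrix $A=(a_{ij})\in\mathbb{N}^{m\times m}$ (where $0\in\mathbb{N}$) is a surjective map $c:V\to\{1,\dots,m\}$ such that, for all $i,j$, every vertex of color $i$ has exactly $a_{ij}$ neighbors of color $j$ (adjacent vertices may have the same color). Call two $m\times m$ matrices equivalent if one arises from the other by a permutation of the colors, i.e. by applying one permutation simultaneously to rows and columns. Let $\mathcal{A}_{m,k}$ be the set of all $A\in\mathbb{N}^{m\times m}$ that are the color adjacency matrix of a perfect $m$-coloring of some connected $k$-regular graph. (a) For $k=3,4,5$ and $m=2,3$, the list below for $(m,k)$ is a complete and irredundant list of $\mathcal{A}_{m,k}$ up to equivalence: every listed matrix is in $\mathcal{A}_{m,k}$, every matrix in $\mathcal{A}_{m,k}$ is equivalent to a listed one, and no two listed matrices are equivalent. Matrices are written by their rows, separated by bars; thus $03|12$ is $\begin{pmatrix}0&3\\1&2\end{pmatrix}$. $(m,k)=(2,3)$: $03|12$, $03|21$, $03|30$, $12|12$, $12|21$, $21|12$. $(m,k)=(2,4)$: $04|13$, $04|22$, $04|31$,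 $04|40$, $13|13$, $13|22$, $13|31$, $22|13$, $22|22$, $31|13$. $(m,k)=(2,5)$: $05|14$, $05|23$, $05|32$, $05|41$, $05|50$, $14|14$, $14|23$, $14|32$, $14|41$, $23|14$, $23|23$, $23|32$, $32|14$, $32|23$, $41|14$. $(m,k)=(3,3)$: $003|003|111$, $003|003|120$, $003|012|111$, $003|012|120$, $003|021|111$, $003|021|210$, $012|102|111$, $012|111|210$, $012|120|102$, $012|120|201$, $030|102|012$, $102|003|120$, $102|012|111$, $102|012|120$, $102|021|111$, $111|111|111$, $111|120|102$, $120|102|012$. $(m,k)=(3,4)$: $004|004|112$, $004|004|121$, $004|004|130$, $004|004|220$, $004|013|112$, $004|013|121$, $004|013|130$, $004|013|220$, $004|022|112$, $004|022|121$, $004|022|211$, $004|022|220$, $004|031|112$, $004|031|211$, $004|031|310$, $013|103|112$, $013|103|220$, $013|121|310$, $013|130|103$, $013|130|202$, $013|130|301$, $022|103|130$, $022|112|121$, $022|121|112$, $022|130|103$, $022|202|112$, $022|202|220$, $022|211|211$, $022|220|103$, $022|220|202$, $040|103|013$, $040|103|022$, $040|112|013$, $040|202|013$, $103|004|121$, $103|004|130$,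 $103|013|112$, $103|013|121$, $103|013|130$, $103|013|220$, $103|022|112$, $103|022|121$, $103|022|220$, $103|031|112$, $103|031|211$, $112|112|112$, $112|121|211$, $112|130|103$, $112|130|202$, $130|103|013$, $130|103|022$, $130|112|013$, $130|202|013$, $202|004|130$, $202|013|121$, $202|013|130$, $202|022|112$, $202|022|121$, $202|031|112$, $211|121|112$, $211|130|103$, $220|103|013$, $220|103|022$, $220|112|013$. $(m,k)=(3,5)$: $005|005|113$, $005|005|122$, $005|005|131$, $005|005|140$, $005|005|221$, $005|005|230$, $005|014|113$, $005|014|122$, $005|014|131$, $005|014|140$, $005|014|221$, $005|014|230$, $005|023|113$, $005|023|122$, $005|023|131$, $005|023|221$, $005|023|230$, $005|023|320$, $005|032|113$, $005|032|122$, $005|032|212$, $005|032|221$, $005|032|320$, $005|041|113$, $005|041|212$, $005|041|311$, $005|041|410$, $014|104|113$, $014|104|221$, $014|122|212$, $014|131|410$, $014|140|104$, $014|140|203$, $014|140|302$, $014|140|401$, $023|113|122$, $023|140|104$, $023|203|113$, $023|203|221$, $023|212|320$, $023|221|311$, $023|230|104$, $023|230|203$, $023|230|302$, $032|230|104$, $032|302|113$,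 $032|320|104$, $050|104|014$, $050|104|023$, $050|104|032$, $050|113|014$, $050|113|023$, $050|122|014$, $050|203|014$, $050|203|023$, $050|212|014$, $050|302|014$, $104|005|122$, $104|005|131$, $104|005|140$, $104|005|230$, $104|014|113$, $104|014|122$, $104|014|131$, $104|014|140$, $104|014|221$, $104|014|230$, $104|023|113$, $104|023|122$, $104|023|131$, $104|023|221$, $104|023|230$, $104|032|113$, $104|032|122$, $104|032|212$, $104|032|221$, $104|032|320$, $104|041|113$, $104|041|212$, $104|041|311$, $113|113|113$, $113|113|221$, $113|131|311$, $113|140|104$, $113|140|203$, $113|140|302$, $122|104|140$, $122|113|131$, $122|122|122$, $122|131|113$, $122|140|104$, $122|212|113$, $122|212|221$, $122|221|212$, $122|230|104$, $122|230|203$, $140|104|014$, $140|104|023$, $140|104|032$, $140|113|014$, $140|113|023$, $140|122|014$, $140|203|014$, $140|203|023$, $140|212|014$, $140|302|014$, $203|005|122$, $203|005|131$, $203|005|140$, $203|014|122$, $203|014|131$, $203|014|140$, $203|014|230$, $203|023|113$, $203|023|122$, $203|023|131$, $203|023|221$, $203|023|230$, $203|032|113$, $203|032|122$, $203|032|221$,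 $203|041|113$, $203|041|212$, $212|122|113$, $212|131|212$, $212|140|104$, $212|140|203$, $230|104|014$, $230|104|023$, $230|104|032$, $230|113|014$, $230|113|023$, $230|122|014$, $230|203|014$, $230|203|023$, $230|212|014$, $302|005|131$, $302|005|140$, $302|014|131$, $302|014|140$, $302|023|122$, $302|023|131$, $302|032|113$, $302|032|122$, $302|041|113$, $311|131|113$, $311|140|104$, $320|104|014$, $320|104|023$, $320|104|032$, $320|113|014$, $320|113|023$, $320|122|014$. (b) The number of equivalence classes of matrices in $\mathcal{A}_{m,k}$ for $k=3,4,5$ is $6,10,15$ for $m=2$; $18,64,153$ for $m=3$; and $72,485,2042$ for $m=4$, respectively. (c) For comparison, the number of all matrices in $\mathbb{N}^{m\times m}$ with all row sums equal to $k$, for $k=3,4,5$, is $16,25,36$ for $m=2$; $1000,3375,9261$ for $m=3$; and $160000,1500625,9834496$ for $m=4$, respectively. -/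

import Mathlib

/-- `c : V → Fin m` is a perfect `m`-coloring of the graph `G` with color adjacency matrix `A`: all
colors are used, and every vertex of color `i` has exactly `A i j` neighbors of color `j`. -/
def IsPerfectColoring {V : Type*} [Fintype V] (G : SimpleGraph V) [DecidableRel G.Adj] {m : ℕ}
    (c : V → Fin m) (A : Matrix (Fin m) (Fin m) ℕ) : Prop :=
  Function.Surjective c ∧
    ∀ (i j : Fin m) (v : V), c v = i → ((G.neighborFinset v).filter (fun w => c w = j)).card = A i j

/-- `A` is the color adjacency matrix of a perfect `m`-coloring of some finite simple connected
`k`-regular graph. -/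
def IsColorAdjacencyMatrix (k : ℕ) {m : ℕ} (A : Matrix (Fin m) (Fin m) ℕ) : Prop :=
  ∃ (V : Type) (_ : Fintype V) (G : SimpleGraph V) (_ : DecidableRel G.Adj) (c : V → Fin m),
    G.Connected ∧ G.IsRegularOfDegree k ∧ IsPerfectColoring G c A

/-- `A` and `B` differ only by a permutation of the colors. -/
def ColorEquiv {m : ℕ} (A B : Matrix (Fin m) (Fin m) ℕ) : Prop :=
  ∃ σ : Equiv.Perm (Fin m), B = A.submatrix σ σ

/-- Equality up to a permutation of the colors, as an equivalence relation. -/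
def colorSetoid (m : ℕ) : Setoid (Matrix (Fin m) (Fin m) ℕ) where
  r := ColorEquiv
  iseqv :=
    { refl := fun A => ⟨1, by ext i j; rfl⟩
      symm := by
        rintro A B ⟨σ, rfl⟩
        exact ⟨σ⁻¹, by ext i j; simp⟩
      trans := by
        rintro A B C ⟨σ, rfl⟩ ⟨τ, rfl⟩
        exact ⟨σ * τ, by ext i j; simp⟩ }

/-- The number of color adjacency matrices of perfect `m`-colorings of connected `k`-regular
graphs, counted up to permutations of the colors. -/
noncomputable def numColorAdjacencyMatrices (m k : ℕ) : ℕ :=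
  (Quotient.mk (colorSetoid m) '' {A | IsColorAdjacencyMatrix k A}).ncard

/-- The number of all nonnegative integer `m × m` matrices with all row sums equal to `k`. -/
noncomputable def numRowSumMatrices (m k : ℕ) : ℕ :=
  {A : Matrix (Fin m) (Fin m) ℕ | ∀ i, ∑ j, A i j = k}.ncard

/-- `L` lists all color adjacency matrices of perfect `m`-colorings of connected `k`-regular graphs
up to permutations of the colors: all its members are such matrices, every such matrix is
equivalent to a member, and no two of its members are equivalent. -/
def IsCompleteList (k : ℕ) {m : ℕ} (L : List (Matrix (Fin m) (Fin m) ℕ)) : Prop :=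
  (∀ A ∈ L, IsColorAdjacencyMatrix k A) ∧
    (∀ A : Matrix (Fin m) (Fin m) ℕ, IsColorAdjacencyMatrix k A → ∃ B ∈ L, ColorEquiv A B) ∧
    L.Pairwise (fun A B => ¬ ColorEquiv A B)

/-- The list for two colors and 3-regular graphs. -/
def twoColorThreeRegular : List (Matrix (Fin 2) (Fin 2) ℕ) :=
  [!![0, 3; 1, 2], !![0, 3; 2, 1], !![0, 3; 3, 0], !![1, 2; 1, 2],
    !![1, 2; 2, 1], !![2, 1; 1, 2]]

/-- The list for two colors and 4-regular graphs. -/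
def twoColorFourRegular : List (Matrix (Fin 2) (Fin 2) ℕ) :=
  [!![0, 4; 1, 3], !![0, 4; 2, 2], !![0, 4; 3, 1], !![0, 4; 4, 0],
    !![1, 3; 1, 3], !![1, 3; 2, 2], !![1, 3; 3, 1], !![2, 2; 1, 3],
    !![2, 2; 2, 2], !![3, 1; 1, 3]]

/-- The list for two colors and 5-regular graphs. -/
def twoColorFiveRegular : List (Matrix (Fin 2) (Fin 2) ℕ) :=
  [!![0, 5; 1, 4], !![0, 5; 2, 3], !![0, 5; 3, 2], !![0, 5; 4, 1],
    !![0, 5; 5, 0], !![1, 4; 1, 4], !![1, 4; 2, 3], !![1, 4; 3, 2],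
    !![1, 4; 4, 1], !![2, 3; 1, 4], !![2, 3; 2, 3], !![2, 3; 3, 2],
    !![3, 2; 1, 4], !![3, 2; 2, 3], !![4, 1; 1, 4]]

/-- The list for three colors and 3-regular graphs. -/
def threeColorThreeRegular : List (Matrix (Fin 3) (Fin 3) ℕ) :=
  [!![0, 0, 3; 0, 0, 3; 1, 1, 1], !![0, 0, 3; 0, 0, 3; 1, 2, 0], !![0, 0, 3; 0, 1, 2; 1, 1, 1],
    !![0, 0, 3; 0, 1, 2; 1, 2, 0], !![0, 0, 3; 0, 2, 1; 1, 1, 1], !![0, 0, 3; 0, 2, 1; 2, 1, 0],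
    !![0, 1, 2; 1, 0, 2; 1, 1, 1], !![0, 1, 2; 1, 1, 1; 2, 1, 0], !![0, 1, 2; 1, 2, 0; 1, 0, 2],
    !![0, 1, 2; 1, 2, 0; 2, 0, 1], !![0, 3, 0; 1, 0, 2; 0, 1, 2], !![1, 0, 2; 0, 0, 3; 1, 2, 0],
    !![1, 0, 2; 0, 1, 2; 1, 1, 1], !![1, 0, 2; 0, 1, 2; 1, 2, 0], !![1, 0, 2; 0, 2, 1; 1, 1, 1],
    !![1, 1, 1; 1, 1, 1; 1, 1, 1], !![1, 1, 1; 1, 2, 0; 1, 0, 2], !![1, 2, 0; 1, 0, 2; 0, 1, 2]]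

/-- The list for three colors and 4-regular graphs. -/
def threeColorFourRegular : List (Matrix (Fin 3) (Fin 3) ℕ) :=
  [!![0, 0, 4; 0, 0, 4; 1, 1, 2], !![0, 0, 4; 0, 0, 4; 1, 2, 1], !![0, 0, 4; 0, 0, 4; 1, 3, 0],
    !![0, 0, 4; 0, 0, 4; 2, 2, 0], !![0, 0, 4; 0, 1, 3; 1, 1, 2], !![0, 0, 4; 0, 1, 3; 1, 2, 1],
    !![0, 0, 4; 0, 1, 3; 1, 3, 0], !![0, 0, 4; 0, 1, 3; 2, 2, 0], !![0, 0, 4; 0, 2, 2; 1, 1, 2],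
    !![0, 0, 4; 0, 2, 2; 1, 2, 1], !![0, 0, 4; 0, 2, 2; 2, 1, 1], !![0, 0, 4; 0, 2, 2; 2, 2, 0],
    !![0, 0, 4; 0, 3, 1; 1, 1, 2], !![0, 0, 4; 0, 3, 1; 2, 1, 1], !![0, 0, 4; 0, 3, 1; 3, 1, 0],
    !![0, 1, 3; 1, 0, 3; 1, 1, 2], !![0, 1, 3; 1, 0, 3; 2, 2, 0], !![0, 1, 3; 1, 2, 1; 3, 1, 0],
    !![0, 1, 3; 1, 3, 0; 1, 0, 3], !![0, 1, 3; 1, 3, 0; 2, 0, 2], !![0, 1, 3; 1, 3, 0; 3, 0, 1],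
    !![0, 2, 2; 1, 0, 3; 1, 3, 0], !![0, 2, 2; 1, 1, 2; 1, 2, 1], !![0, 2, 2; 1, 2, 1; 1, 1, 2],
    !![0, 2, 2; 1, 3, 0; 1, 0, 3], !![0, 2, 2; 2, 0, 2; 1, 1, 2], !![0, 2, 2; 2, 0, 2; 2, 2, 0],
    !![0, 2, 2; 2, 1, 1; 2, 1, 1], !![0, 2, 2; 2, 2, 0; 1, 0, 3], !![0, 2, 2; 2, 2, 0; 2, 0, 2],
    !![0, 4, 0; 1, 0, 3; 0, 1, 3], !![0, 4, 0; 1, 0, 3; 0, 2, 2], !![0, 4, 0; 1, 1, 2; 0, 1, 3],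
    !![0, 4, 0; 2, 0, 2; 0, 1, 3], !![1, 0, 3; 0, 0, 4; 1, 2, 1], !![1, 0, 3; 0, 0, 4; 1, 3, 0],
    !![1, 0, 3; 0, 1, 3; 1, 1, 2], !![1, 0, 3; 0, 1, 3; 1, 2, 1], !![1, 0, 3; 0, 1, 3; 1, 3, 0],
    !![1, 0, 3; 0, 1, 3; 2, 2, 0], !![1, 0, 3; 0, 2, 2; 1, 1, 2], !![1, 0, 3; 0, 2, 2; 1, 2, 1],
    !![1, 0, 3; 0, 2, 2; 2, 2, 0], !![1, 0, 3; 0, 3, 1; 1, 1, 2], !![1, 0, 3; 0, 3, 1; 2, 1, 1],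
    !![1, 1, 2; 1, 1, 2; 1, 1, 2], !![1, 1, 2; 1, 2, 1; 2, 1, 1], !![1, 1, 2; 1, 3, 0; 1, 0, 3],
    !![1, 1, 2; 1, 3, 0; 2, 0, 2], !![1, 3, 0; 1, 0, 3; 0, 1, 3], !![1, 3, 0; 1, 0, 3; 0, 2, 2],
    !![1, 3, 0; 1, 1, 2; 0, 1, 3], !![1, 3, 0; 2, 0, 2; 0, 1, 3], !![2, 0, 2; 0, 0, 4; 1, 3, 0],
    !![2, 0, 2; 0, 1, 3; 1, 2, 1], !![2, 0, 2; 0, 1, 3; 1, 3, 0], !![2, 0, 2; 0, 2, 2; 1, 1, 2],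
    !![2, 0, 2; 0, 2, 2; 1, 2, 1], !![2, 0, 2; 0, 3, 1; 1, 1, 2], !![2, 1, 1; 1, 2, 1; 1, 1, 2],
    !![2, 1, 1; 1, 3, 0; 1, 0, 3], !![2, 2, 0; 1, 0, 3; 0, 1, 3], !![2, 2, 0; 1, 0, 3; 0, 2, 2],
    !![2, 2, 0; 1, 1, 2; 0, 1, 3]]

/-- The list for three colors and 5-regular graphs. -/
def threeColorFiveRegular : List (Matrix (Fin 3) (Fin 3) ℕ) :=
  [!![0, 0, 5; 0, 0, 5; 1, 1, 3], !![0, 0, 5; 0, 0, 5; 1, 2, 2], !![0, 0, 5; 0, 0, 5; 1, 3, 1],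
    !![0, 0, 5; 0, 0, 5; 1, 4, 0], !![0, 0, 5; 0, 0, 5; 2, 2, 1], !![0, 0, 5; 0, 0, 5; 2, 3, 0],
    !![0, 0, 5; 0, 1, 4; 1, 1, 3], !![0, 0, 5; 0, 1, 4; 1, 2, 2], !![0, 0, 5; 0, 1, 4; 1, 3, 1],
    !![0, 0, 5; 0, 1, 4; 1, 4, 0], !![0, 0, 5; 0, 1, 4; 2, 2, 1], !![0, 0, 5; 0, 1, 4; 2, 3, 0],
    !![0, 0, 5; 0, 2, 3; 1, 1, 3], !![0, 0, 5; 0, 2, 3; 1, 2, 2], !![0, 0, 5; 0, 2, 3; 1, 3, 1],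
    !![0, 0, 5; 0, 2, 3; 2, 2, 1], !![0, 0, 5; 0, 2, 3; 2, 3, 0], !![0, 0, 5; 0, 2, 3; 3, 2, 0],
    !![0, 0, 5; 0, 3, 2; 1, 1, 3], !![0, 0, 5; 0, 3, 2; 1, 2, 2], !![0, 0, 5; 0, 3, 2; 2, 1, 2],
    !![0, 0, 5; 0, 3, 2; 2, 2, 1], !![0, 0, 5; 0, 3, 2; 3, 2, 0], !![0, 0, 5; 0, 4, 1; 1, 1, 3],
    !![0, 0, 5; 0, 4, 1; 2, 1, 2], !![0, 0, 5; 0, 4, 1; 3, 1, 1], !![0, 0, 5; 0, 4, 1; 4, 1, 0],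
    !![0, 1, 4; 1, 0, 4; 1, 1, 3], !![0, 1, 4; 1, 0, 4; 2, 2, 1], !![0, 1, 4; 1, 2, 2; 2, 1, 2],
    !![0, 1, 4; 1, 3, 1; 4, 1, 0], !![0, 1, 4; 1, 4, 0; 1, 0, 4], !![0, 1, 4; 1, 4, 0; 2, 0, 3],
    !![0, 1, 4; 1, 4, 0; 3, 0, 2], !![0, 1, 4; 1, 4, 0; 4, 0, 1], !![0, 2, 3; 1, 1, 3; 1, 2, 2],
    !![0, 2, 3; 1, 4, 0; 1, 0, 4], !![0, 2, 3; 2, 0, 3; 1, 1, 3], !![0, 2, 3; 2, 0, 3; 2, 2, 1],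
    !![0, 2, 3; 2, 1, 2; 3, 2, 0], !![0, 2, 3; 2, 2, 1; 3, 1, 1], !![0, 2, 3; 2, 3, 0; 1, 0, 4],
    !![0, 2, 3; 2, 3, 0; 2, 0, 3], !![0, 2, 3; 2, 3, 0; 3, 0, 2], !![0, 3, 2; 2, 3, 0; 1, 0, 4],
    !![0, 3, 2; 3, 0, 2; 1, 1, 3], !![0, 3, 2; 3, 2, 0; 1, 0, 4], !![0, 5, 0; 1, 0, 4; 0, 1, 4],
    !![0, 5, 0; 1, 0, 4; 0, 2, 3], !![0, 5, 0; 1, 0, 4; 0, 3, 2], !![0, 5, 0; 1, 1, 3; 0, 1, 4],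
    !![0, 5, 0; 1, 1, 3; 0, 2, 3], !![0, 5, 0; 1, 2, 2; 0, 1, 4], !![0, 5, 0; 2, 0, 3; 0, 1, 4],
    !![0, 5, 0; 2, 0, 3; 0, 2, 3], !![0, 5, 0; 2, 1, 2; 0, 1, 4], !![0, 5, 0; 3, 0, 2; 0, 1, 4],
    !![1, 0, 4; 0, 0, 5; 1, 2, 2], !![1, 0, 4; 0, 0, 5; 1, 3, 1], !![1, 0, 4; 0, 0, 5; 1, 4, 0],
    !![1, 0, 4; 0, 0, 5; 2, 3, 0], !![1, 0, 4; 0, 1, 4; 1, 1, 3], !![1, 0, 4; 0, 1, 4; 1, 2, 2],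
    !![1, 0, 4; 0, 1, 4; 1, 3, 1], !![1, 0, 4; 0, 1, 4; 1, 4, 0], !![1, 0, 4; 0, 1, 4; 2, 2, 1],
    !![1, 0, 4; 0, 1, 4; 2, 3, 0], !![1, 0, 4; 0, 2, 3; 1, 1, 3], !![1, 0, 4; 0, 2, 3; 1, 2, 2],
    !![1, 0, 4; 0, 2, 3; 1, 3, 1], !![1, 0, 4; 0, 2, 3; 2, 2, 1], !![1, 0, 4; 0, 2, 3; 2, 3, 0],
    !![1, 0, 4; 0, 3, 2; 1, 1, 3], !![1, 0, 4; 0, 3, 2; 1, 2, 2], !![1, 0, 4; 0, 3, 2; 2, 1, 2],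
    !![1, 0, 4; 0, 3, 2; 2, 2, 1], !![1, 0, 4; 0, 3, 2; 3, 2, 0], !![1, 0, 4; 0, 4, 1; 1, 1, 3],
    !![1, 0, 4; 0, 4, 1; 2, 1, 2], !![1, 0, 4; 0, 4, 1; 3, 1, 1], !![1, 1, 3; 1, 1, 3; 1, 1, 3],
    !![1, 1, 3; 1, 1, 3; 2, 2, 1], !![1, 1, 3; 1, 3, 1; 3, 1, 1], !![1, 1, 3; 1, 4, 0; 1, 0, 4],
    !![1, 1, 3; 1, 4, 0; 2, 0, 3], !![1, 1, 3; 1, 4, 0; 3, 0, 2], !![1, 2, 2; 1, 0, 4; 1, 4, 0],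
    !![1, 2, 2; 1, 1, 3; 1, 3, 1], !![1, 2, 2; 1, 2, 2; 1, 2, 2], !![1, 2, 2; 1, 3, 1; 1, 1, 3],
    !![1, 2, 2; 1, 4, 0; 1, 0, 4], !![1, 2, 2; 2, 1, 2; 1, 1, 3], !![1, 2, 2; 2, 1, 2; 2, 2, 1],
    !![1, 2, 2; 2, 2, 1; 2, 1, 2], !![1, 2, 2; 2, 3, 0; 1, 0, 4], !![1, 2, 2; 2, 3, 0; 2, 0, 3],
    !![1, 4, 0; 1, 0, 4; 0, 1, 4], !![1, 4, 0; 1, 0, 4; 0, 2, 3], !![1, 4, 0; 1, 0, 4; 0, 3, 2],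
    !![1, 4, 0; 1, 1, 3; 0, 1, 4], !![1, 4, 0; 1, 1, 3; 0, 2, 3], !![1, 4, 0; 1, 2, 2; 0, 1, 4],
    !![1, 4, 0; 2, 0, 3; 0, 1, 4], !![1, 4, 0; 2, 0, 3; 0, 2, 3], !![1, 4, 0; 2, 1, 2; 0, 1, 4],
    !![1, 4, 0; 3, 0, 2; 0, 1, 4], !![2, 0, 3; 0, 0, 5; 1, 2, 2], !![2, 0, 3; 0, 0, 5; 1, 3, 1],
    !![2, 0, 3; 0, 0, 5; 1, 4, 0], !![2, 0, 3; 0, 1, 4; 1, 2, 2], !![2, 0, 3; 0, 1, 4; 1, 3, 1],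
    !![2, 0, 3; 0, 1, 4; 1, 4, 0], !![2, 0, 3; 0, 1, 4; 2, 3, 0], !![2, 0, 3; 0, 2, 3; 1, 1, 3],
    !![2, 0, 3; 0, 2, 3; 1, 2, 2], !![2, 0, 3; 0, 2, 3; 1, 3, 1], !![2, 0, 3; 0, 2, 3; 2, 2, 1],
    !![2, 0, 3; 0, 2, 3; 2, 3, 0], !![2, 0, 3; 0, 3, 2; 1, 1, 3], !![2, 0, 3; 0, 3, 2; 1, 2, 2],
    !![2, 0, 3; 0, 3, 2; 2, 2, 1], !![2, 0, 3; 0, 4, 1; 1, 1, 3], !![2, 0, 3; 0, 4, 1; 2, 1, 2],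
    !![2, 1, 2; 1, 2, 2; 1, 1, 3], !![2, 1, 2; 1, 3, 1; 2, 1, 2], !![2, 1, 2; 1, 4, 0; 1, 0, 4],
    !![2, 1, 2; 1, 4, 0; 2, 0, 3], !![2, 3, 0; 1, 0, 4; 0, 1, 4], !![2, 3, 0; 1, 0, 4; 0, 2, 3],
    !![2, 3, 0; 1, 0, 4; 0, 3, 2], !![2, 3, 0; 1, 1, 3; 0, 1, 4], !![2, 3, 0; 1, 1, 3; 0, 2, 3],
    !![2, 3, 0; 1, 2, 2; 0, 1, 4], !![2, 3, 0; 2, 0, 3; 0, 1, 4], !![2, 3, 0; 2, 0, 3; 0, 2, 3],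
    !![2, 3, 0; 2, 1, 2; 0, 1, 4], !![3, 0, 2; 0, 0, 5; 1, 3, 1], !![3, 0, 2; 0, 0, 5; 1, 4, 0],
    !![3, 0, 2; 0, 1, 4; 1, 3, 1], !![3, 0, 2; 0, 1, 4; 1, 4, 0], !![3, 0, 2; 0, 2, 3; 1, 2, 2],
    !![3, 0, 2; 0, 2, 3; 1, 3, 1], !![3, 0, 2; 0, 3, 2; 1, 1, 3], !![3, 0, 2; 0, 3, 2; 1, 2, 2],
    !![3, 0, 2; 0, 4, 1; 1, 1, 3], !![3, 1, 1; 1, 3, 1; 1, 1, 3], !![3, 1, 1; 1, 4, 0; 1, 0, 4],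
    !![3, 2, 0; 1, 0, 4; 0, 1, 4], !![3, 2, 0; 1, 0, 4; 0, 2, 3], !![3, 2, 0; 1, 0, 4; 0, 3, 2],
    !![3, 2, 0; 1, 1, 3; 0, 1, 4], !![3, 2, 0; 1, 1, 3; 0, 2, 3], !![3, 2, 0; 1, 2, 2; 0, 1, 4]]

namespace ColorMatrix

open Finset

/-- The arithmetic conditions that characterize color adjacency matrices: constant row sums, positive
weights satisfying the detailed balance equations, and an irreducible support. -/
structure IsAdmissible (k : ℕ) {m : ℕ} (A : Matrix (Fin m) (Fin m) ℕ) : Prop where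
  row_sum : ∀ i, ∑ j, A i j = k
  balanced : ∃ w : Fin m → ℕ, (∀ i, 0 < w i) ∧ ∀ i j, w i * A i j = w j * A j i
  irreducible : ∀ f : Fin m → Bool, (∀ i j, A i j ≠ 0 → f i = f j) → ∀ i j, f i = f j

variable {m k : ℕ} {A : Matrix (Fin m) (Fin m) ℕ}

section Necessity

variable {V : Type*} [Fintype V] {G : SimpleGraph V} [DecidableRel G.Adj] {c : V → Fin m}

theorem degree_eq_sum (hc : IsPerfectColoring G c A) (v : V) : G.degree v = ∑ j, A (c v) j := by
  rw [← G.card_neighborFinset_eq_degree,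
    Finset.card_eq_sum_card_fiberwise (f := c) (t := univ) (fun _ _ => by simp)]
  exact Finset.sum_congr rfl fun j _ => hc.2 _ j v rfl

theorem IsAdmissible.of_isPerfectColoring (hG : G.Connected) (hk : G.IsRegularOfDegree k)
    (hc : IsPerfectColoring G c A) : IsAdmissible k A where
  row_sum i := by
    obtain ⟨v, rfl⟩ := hc.1 i
    rw [← degree_eq_sum hc, hk v]
  balanced := by
    classical
    refine ⟨fun i => #{v | c v = i}, fun i => ?_, fun i j => ?_⟩
    · obtain ⟨v, rfl⟩ := hc.1 i
      exact Finset.card_pos.2 ⟨v, by simp⟩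
    · refine Finset.card_mul_eq_card_mul G.Adj (fun v hv => ?_) (fun v hv => ?_)
      · rw [← hc.2 i j v (by simpa using hv)]
        congr 1
        ext u
        simp [Finset.mem_bipartiteAbove, and_comm]
      · rw [← hc.2 j i v (by simpa using hv)]
        congr 1
        ext u
        simp [Finset.mem_bipartiteBelow, and_comm, G.adj_comm]
  irreducible f hf i j := by
    obtain ⟨v, rfl⟩ := hc.1 i
    obtain ⟨u, rfl⟩ := hc.1 j
    obtain ⟨p⟩ := hG.preconnected v u
    induction p with
    | nil => rfl
    | @cons a b _ h _ ih =>
      refine (hf _ _ ?_).trans ih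
      rw [← hc.2 (c a) (c b) a rfl]
      exact Finset.card_ne_zero.2 ⟨b, by simpa using h⟩

end Necessity

section Biregular

/-- A biregular relation between initial segments of `ℕ`: the edges `e < N * a` are spread over
the left vertices by residues and over the right vertices by quotients. -/
def BiregularRel (N a b x y : ℕ) : Prop := ∃ e < N * a, e % N = x ∧ e / b = y

open Classical in
theorem card_biregularRel_right {N M a b : ℕ} (h : N * a = M * b) (hN : 0 < N) (hb : b ≤ N)
    (x : Fin N) : #{y : Fin M | BiregularRel N a b x y} = a := by
  rcases Nat.eq_zero_or_pos a with rfl | ha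
  · simp [BiregularRel]
  have hb0 : 0 < b := by
    rcases Nat.eq_zero_or_pos b with rfl | hb0
    · simp at h; omega
    · exact hb0
  have hlt : ∀ t < a, (x + N * t : ℕ) < N * a := fun t ht => by
    have := Nat.mul_le_mul_left N (Nat.succ_le_of_lt ht)
    rw [Nat.mul_succ] at this
    have := x.2
    omega
  have hltM : ∀ t < a, (x + N * t : ℕ) / b < M := fun t ht =>
    Nat.div_lt_of_lt_mul (by rw [mul_comm b, ← h]; exact hlt t ht)
  symm
  conv_lhs => rw [← Finset.card_range a]
  refine Finset.card_bij (fun t ht => ⟨(x + N * t : ℕ) / b, hltM t (by simpa using ht)⟩) ?_ ?_ ?_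
  · intro t ht
    simp only [mem_filter, mem_univ, true_and]
    exact ⟨_, hlt t (by simpa using ht), by simp [Nat.mod_eq_of_lt x.2], rfl⟩
  · have key : ∀ t s : ℕ, t < s → (x + N * t : ℕ) / b < (x + N * s : ℕ) / b := fun t s hts => by
      have h1 := Nat.mul_le_mul_left N (Nat.succ_le_of_lt hts)
      rw [Nat.mul_succ] at h1
      have h2 : (x + N * t + b : ℕ) / b ≤ (x + N * s : ℕ) / b := Nat.div_le_div_right (by omega)
      rw [Nat.add_div_right _ hb0] at h2
      omega
    intro t ht s hs hts
    simp only [Fin.mk.injEq] at hts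
    rcases lt_trichotomy t s with h' | h' | h'
    · have := key _ _ h'; omega
    · exact h'
    · have := key _ _ h'; omega
  · intro y hy
    simp only [mem_filter, mem_univ, true_and] at hy
    obtain ⟨e, he, hex, hey⟩ := hy
    refine ⟨e / N, by simpa using Nat.div_lt_of_lt_mul he, ?_⟩
    ext
    simp only
    rw [← hex, Nat.mod_add_div, hey]

open Classical in
theorem card_biregularRel_left {N M a b : ℕ} (h : N * a = M * b) (hb : b ≤ N)
    (y : Fin M) : #{x : Fin N | BiregularRel N a b x y} = b := by
  rcases Nat.eq_zero_or_pos b with rfl | hb0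
  · rw [Finset.card_eq_zero, Finset.filter_eq_empty_iff]
    rintro x - ⟨e, he, -⟩
    simp [h] at he
  have hN : 0 < N := by omega
  symm
  conv_lhs => rw [← Finset.card_range b]
  refine Finset.card_bij (fun t _ => ⟨(b * y + t : ℕ) % N, Nat.mod_lt _ hN⟩) ?_ ?_ ?_
  · intro t ht
    have ht : t < b := by simpa using ht
    simp only [mem_filter, mem_univ, true_and]
    refine ⟨b * y + t, ?_, rfl, ?_⟩
    · rw [h, mul_comm M]
      have := Nat.mul_le_mul_left b (Nat.succ_le_of_lt y.2)
      rw [Nat.mul_succ] at this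
      omega
    · rw [Nat.mul_add_div hb0, Nat.div_eq_of_lt ht, add_zero]
  · intro t ht s hs hts
    simp only [Fin.mk.injEq] at hts
    have ht : t < b := by simpa using ht
    have hs : s < b := by simpa using hs
    have h1 : t ≡ s [MOD N] := Nat.ModEq.add_left_cancel' (b * y) hts
    exact h1.eq_of_lt_of_lt (by omega) (by omega)
  · intro x hx
    simp only [mem_filter, mem_univ, true_and] at hx
    obtain ⟨e, he, hex, hey⟩ := hx
    refine ⟨e % b, by simpa using Nat.mod_lt _ hb0, ?_⟩
    ext
    simp only
    rw [← hey, Nat.div_add_mod, hex]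

end Biregular

section Sufficiency

/-- The bipartite double cover of a relation on a type of colored points. -/
def doubleCover {W : Type*} (R : W → W → Prop) : SimpleGraph (W × Bool) where
  Adj p q := (p.2 = false ∧ q.2 = true ∧ R p.1 q.1) ∨ (p.2 = true ∧ q.2 = false ∧ R q.1 p.1)
  symm := ⟨fun p q h => by tauto⟩
  loopless := ⟨fun p h => by rcases h with ⟨h1, h2, -⟩ | ⟨h1, h2, -⟩ <;> simp [h1] at h2⟩

open Classical in
theorem exists_isPerfectColoring (h : IsAdmissible k A) :
    ∃ (V : Type) (_ : Fintype V) (G : SimpleGraph V) (c : V → Fin m),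
      (∀ i, ∃ v, c v = i) ∧ IsPerfectColoring G c A := by
  obtain ⟨w, hw, hbal⟩ := h.balanced
  set N : Fin m → ℕ := fun i => w i * (k + 1) with hN
  have hNpos : ∀ i, 0 < N i := fun i => Nat.mul_pos (hw i) (Nat.succ_pos k)
  have hNbal : ∀ i j, N i * A i j = N j * A j i := fun i j => by
    simp only [hN]
    linear_combination (k + 1) * hbal i j
  have hle : ∀ i j l, A i j ≤ N l := fun i j l => by
    have h1 : A i j ≤ ∑ j, A i j := Finset.single_le_sum (fun _ _ => Nat.zero_le _) (mem_univ j)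
    have h2 : 1 * (k + 1) ≤ w l * (k + 1) := Nat.mul_le_mul_right _ (hw l)
    rw [h.row_sum] at h1
    simp only [hN]
    omega
  let R : (Σ i, Fin (N i)) → (Σ i, Fin (N i)) → Prop := fun p q =>
    BiregularRel (N p.1) (A p.1 q.1) (A q.1 p.1) p.2 q.2
  have hsurj : ∀ i, ∃ v : (Σ i, Fin (N i)) × Bool, v.1.1 = i :=
    fun i => ⟨(⟨i, ⟨0, hNpos i⟩⟩, true), rfl⟩
  refine ⟨(Σ i, Fin (N i)) × Bool, inferInstance, doubleCover R, fun v => v.1.1, hsurj, hsurj, ?_⟩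
  rintro _ j ⟨⟨i, x⟩, b⟩ rfl
  dsimp only
  cases b
  · rw [← card_biregularRel_right (hNbal i j) (hNpos i) (hle j i i) x]
    symm
    refine Finset.card_bij (fun y _ => (⟨j, y⟩, true)) ?_ ?_ ?_
    · intro y hy
      simp only [mem_filter, mem_univ, true_and] at hy
      rw [mem_filter, SimpleGraph.mem_neighborFinset]
      simpa [doubleCover, R] using hy
    · intro y _ z _ hyz
      simpa using hyz
    · rintro ⟨⟨j', y⟩, b⟩ hy
      simp only [mem_filter, SimpleGraph.mem_neighborFinset] at hy
      obtain ⟨hy, rfl⟩ := hy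
      rcases hy with ⟨-, hb, hr⟩ | ⟨hb, -⟩
      · exact ⟨y, by simpa [R] using hr, by simpa using hb.symm⟩
      · simp at hb
  · rw [← card_biregularRel_left (hNbal j i) (hle i j j) x]
    symm
    refine Finset.card_bij (fun y _ => (⟨j, y⟩, false)) ?_ ?_ ?_
    · intro y hy
      simp only [mem_filter, mem_univ, true_and] at hy
      rw [mem_filter, SimpleGraph.mem_neighborFinset]
      simpa [doubleCover, R] using hy
    · intro y _ z _ hyz
      simpa using hyz
    · rintro ⟨⟨j', y⟩, b⟩ hy
      simp only [mem_filter, SimpleGraph.mem_neighborFinset] at hy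
      obtain ⟨hy, rfl⟩ := hy
      rcases hy with ⟨hb, -⟩ | ⟨-, hb, hr⟩
      · simp at hb
      · exact ⟨y, by simpa [R] using hr, by simpa using hb.symm⟩

theorem IsAdmissible.isColorAdjacencyMatrix [NeZero m] (h : IsAdmissible k A) :
    IsColorAdjacencyMatrix k A := by
  classical
  obtain ⟨V, _, G, c, hsurj, hc⟩ := exists_isPerfectColoring h
  obtain ⟨w, hw, hbal⟩ := h.balanced
  obtain ⟨v₀, hv₀⟩ := hsurj 0
  let C := G.connectedComponentMk v₀
  have hadj : ∀ {v u : V}, v ∈ C.supp → G.Adj v u → u ∈ C.supp := fun {v u} hv hvu =>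
    SimpleGraph.ConnectedComponent.mem_supp_of_adj_mem_supp _ hv hvu
  have hcount : ∀ (v : C.supp) (j : Fin m),
      #{u ∈ C.toSimpleGraph.neighborFinset v | c u.1 = j} = A (c v.1) j := fun v j => by
    rw [← hc.2 (c v.1) j v.1 rfl]
    refine Finset.card_bij (fun u _ => u.1) ?_ ?_ ?_
    · intro u hu
      rw [mem_filter, SimpleGraph.mem_neighborFinset] at hu ⊢
      exact hu
    · intro u _ u' _ huu
      exact Subtype.ext huu
    · intro u hu
      have hu' : G.Adj v.1 u ∧ c u = j := by simpa using hu
      refine ⟨⟨u, hadj v.2 hu'.1⟩, ?_, rfl⟩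
      rw [mem_filter, SimpleGraph.mem_neighborFinset]
      exact hu'
  have step : ∀ i j, A i j ≠ 0 → (∃ v ∈ C.supp, c v = i) → ∃ v ∈ C.supp, c v = j := by
    rintro _ j hij ⟨v, hv, rfl⟩
    rw [← hcount ⟨v, hv⟩ j] at hij
    obtain ⟨u, hu⟩ := Finset.card_ne_zero.1 hij
    exact ⟨u.1, u.2, by simpa using (Finset.mem_filter.1 hu).2⟩
  have hzero : ∀ i j, A i j ≠ 0 → A j i ≠ 0 := fun i j hij hji => by
    have := hbal i j
    rw [hji, mul_zero] at this
    exact (Nat.mul_ne_zero (hw i).ne' hij) this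
  have hC : Function.Surjective fun v : C.supp => c v.1 := fun i => by
    have h1 := h.irreducible (fun i => decide (∃ v ∈ C.supp, c v = i)) (fun i j hij => by
      simp only [decide_eq_decide]
      exact ⟨step i j hij, step j i (hzero i j hij)⟩) 0 i
    simp only [decide_eq_decide] at h1
    obtain ⟨v, hv, hvi⟩ := h1.1 ⟨v₀, rfl, hv₀⟩
    exact ⟨⟨v, hv⟩, hvi⟩
  have hperf : IsPerfectColoring C.toSimpleGraph (fun v : C.supp => c v.1) A := by
    refine ⟨hC, ?_⟩
    rintro _ j v rfl
    convert hcount v j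
  refine ⟨C.supp, _, C.toSimpleGraph, _, fun v => c v.1, C.connected_toSimpleGraph,
    fun v => ?_, hperf⟩
  rw [degree_eq_sum hperf, h.row_sum]

end Sufficiency

theorem isColorAdjacencyMatrix_iff [NeZero m] :
    IsColorAdjacencyMatrix k A ↔ IsAdmissible k A :=
  ⟨fun ⟨_, _, _, _, _, hG, hk, hc⟩ => .of_isPerfectColoring hG hk hc,
    fun h => h.isColorAdjacencyMatrix⟩

variable {m k : ℕ} {A B : Matrix (Fin m) (Fin m) ℕ}

theorem IsAdmissible.submatrix (h : IsAdmissible k A) (σ : Equiv.Perm (Fin m)) :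
    IsAdmissible k (A.submatrix σ σ) where
  row_sum i := (Equiv.sum_comp σ fun j => A (σ i) j).trans (h.row_sum _)
  balanced := by
    obtain ⟨w, hw, hbal⟩ := h.balanced
    exact ⟨w ∘ σ, fun i => hw _, fun i j => hbal _ _⟩
  irreducible f hf i j := by
    have := h.irreducible (f ∘ σ.symm) (fun i j hij => hf _ _ (by simpa using hij)) (σ i) (σ j)
    simpa using this

theorem IsAdmissible.le (h : IsAdmissible k A) (i j : Fin m) : A i j ≤ k := by
  rw [← h.row_sum i]
  exact Finset.single_le_sum (f := A i) (fun _ _ => Nat.zero_le _) (mem_univ j)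

/-- `A` has increasing diagonal and the least code among the matrices that arise from it by
permutations of the colors which preserve the diagonal. -/
structure IsCanonical (code : Matrix (Fin m) (Fin m) ℕ → ℕ) (A : Matrix (Fin m) (Fin m) ℕ) :
    Prop where
  monotone : Monotone fun i => A i i
  code_le : ∀ σ : Equiv.Perm (Fin m), (∀ i, A (σ i) (σ i) = A i i) →
    code A ≤ code (A.submatrix σ σ)

theorem exists_isCanonical (code : Matrix (Fin m) (Fin m) ℕ → ℕ) (A : Matrix (Fin m) (Fin m) ℕ) :
    ∃ σ : Equiv.Perm (Fin m), IsCanonical code (A.submatrix σ σ) := by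
  classical
  obtain ⟨σ, hσ, hmin⟩ := Finset.exists_min_image
    {σ : Equiv.Perm (Fin m) | Monotone fun i => A (σ i) (σ i)}
    (fun σ => code (A.submatrix σ σ))
    ⟨Tuple.sort fun i => A i i, mem_filter.2 ⟨mem_univ _, Tuple.monotone_sort fun i => A i i⟩⟩
  simp only [mem_filter, mem_univ, true_and] at hσ hmin
  refine ⟨σ, hσ, fun τ hτ => hmin (σ * τ) ?_⟩
  simp only [Matrix.submatrix_apply] at hτ
  simpa [hτ] using hσ

theorem IsCanonical.eq_of_colorEquiv {code : Matrix (Fin m) (Fin m) ℕ → ℕ}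
    (hA : IsCanonical code A) (hB : IsCanonical code B) (hAB : ColorEquiv A B)
    (hcode : code A = code B → A = B) : A = B := by
  obtain ⟨σ, rfl⟩ := hAB
  have hdiag : (fun i => A i i) ∘ σ = (fun i => A i i) ∘ (1 : Equiv.Perm (Fin m)) :=
    Tuple.unique_monotone hB.monotone hA.monotone
  have hd : ∀ i, A (σ i) (σ i) = A i i := fun i => congrFun hdiag i
  refine hcode (le_antisymm (hA.code_le σ hd) ?_)
  have h := hB.code_le σ⁻¹ fun i => by
    simp only [Matrix.submatrix_apply, hd]
    rw [← hd, Equiv.Perm.inv_def, Equiv.apply_symm_apply]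
  have he : (A.submatrix σ σ).submatrix (σ⁻¹ : Equiv.Perm (Fin m)) (σ⁻¹ : Equiv.Perm (Fin m)) = A := by
    ext i j
    simp
  rwa [he] at h

theorem numColorAdjacencyMatrices_eq_ncard [NeZero m] (code : Matrix (Fin m) (Fin m) ℕ → ℕ)
    (hcode : ∀ A B : Matrix (Fin m) (Fin m) ℕ, (∀ i j, A i j ≤ k) → (∀ i j, B i j ≤ k) →
      code A = code B → A = B) :
    numColorAdjacencyMatrices m k = {A | IsAdmissible k A ∧ IsCanonical code A}.ncard := by
  rw [numColorAdjacencyMatrices, ← Set.InjOn.ncard_image (f := Quotient.mk (colorSetoid m))]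
  · congr 1
    ext q
    simp only [Set.mem_image, Set.mem_ofPred_eq, isColorAdjacencyMatrix_iff]
    constructor
    · rintro ⟨A, hA, rfl⟩
      obtain ⟨σ, hσ⟩ := exists_isCanonical code A
      exact ⟨_, ⟨hA.submatrix σ, hσ⟩, (Quotient.sound ⟨σ, rfl⟩ : Quotient.mk (colorSetoid m) A = _).symm⟩
    · rintro ⟨A, hA, rfl⟩
      exact ⟨A, hA.1, rfl⟩
  · rintro A ⟨hA, hA'⟩ B ⟨hB, hB'⟩ hAB
    exact hA'.eq_of_colorEquiv hB' (Quotient.exact hAB) (hcode A B hA.le hB.le)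

theorem isCompleteList_of_length [NeZero m] {L : List (Matrix (Fin m) (Fin m) ℕ)} (hL : L ≠ [])
    (hadm : ∀ A ∈ L, IsAdmissible k A) (hpw : L.Pairwise fun A B => ¬ ColorEquiv A B)
    (hcard : numColorAdjacencyMatrices m k = L.length) : IsCompleteList k L := by
  classical
  refine ⟨fun A hA => (hadm A hA).isColorAdjacencyMatrix, fun A hA => ?_, hpw⟩
  have hnodup : (L.map (Quotient.mk (colorSetoid m))).Nodup :=
    List.pairwise_map.2 (hpw.imp fun h he => h (Quotient.exact he))
  set T := (L.map (Quotient.mk (colorSetoid m))).toFinset with hT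
  have hTcard : (T : Set (Quotient (colorSetoid m))).ncard = L.length := by
    rw [Set.ncard_coe_finset, hT, List.toFinset_card_of_nodup hnodup, List.length_map]
  have hpos : numColorAdjacencyMatrices m k ≠ 0 := by
    rw [hcard]
    exact (List.length_pos_of_ne_nil hL).ne'
  have hsub : (T : Set (Quotient (colorSetoid m))) ⊆
      Quotient.mk (colorSetoid m) '' {A | IsColorAdjacencyMatrix k A} := by
    intro q hq
    simp only [hT, Finset.mem_coe, List.mem_toFinset, List.mem_map] at hq
    obtain ⟨B, hB, rfl⟩ := hq
    exact ⟨B, (hadm B hB).isColorAdjacencyMatrix, rfl⟩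
  have heq := Set.eq_of_subset_of_ncard_le hsub
    (by rw [hTcard, ← hcard]; rfl) (Set.finite_of_ncard_ne_zero hpos)
  have hA' : Quotient.mk (colorSetoid m) A ∈ (T : Set (Quotient (colorSetoid m))) := by
    rw [heq]
    exact ⟨A, hA, rfl⟩
  simp only [hT, Finset.mem_coe, List.mem_toFinset, List.mem_map] at hA'
  obtain ⟨B, hB, hBA⟩ := hA'
  exact ⟨B, hB, Quotient.exact hBA.symm⟩

theorem numColorAdjacencyMatrices_eq_length {L : List (Matrix (Fin m) (Fin m) ℕ)}
    (h : IsCompleteList k L) : numColorAdjacencyMatrices m k = L.length := by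
  classical
  have hnodup : (L.map (Quotient.mk (colorSetoid m))).Nodup :=
    List.pairwise_map.2 (h.2.2.imp fun h he => h (Quotient.exact he))
  rw [← List.length_map (Quotient.mk (colorSetoid m)), ← List.toFinset_card_of_nodup hnodup,
    ← Set.ncard_coe_finset, numColorAdjacencyMatrices]
  congr 1
  ext q
  simp only [Finset.mem_coe, List.mem_toFinset, List.mem_map, Set.mem_image, Set.mem_ofPred_eq]
  constructor
  · rintro ⟨A, hA, rfl⟩
    obtain ⟨B, hB, hAB⟩ := h.2.1 A hA
    exact ⟨B, hB, (Quotient.sound hAB : Quotient.mk (colorSetoid m) A = _).symm⟩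
  · rintro ⟨A, hA, rfl⟩
    exact ⟨A, h.1 A hA, rfl⟩

theorem sum_piFinset_succ {α : Type*} (s : Finset α) (n : ℕ) (F : (Fin (n + 1) → α) → ℕ) :
    ∑ A ∈ Fintype.piFinset (fun _ : Fin (n + 1) => s), F A =
      ∑ r ∈ s, ∑ B ∈ Fintype.piFinset (fun _ : Fin n => s), F (Matrix.vecCons r B) := by
  rw [← Finset.sum_product']
  symm
  refine Finset.sum_bij' (fun p _ => Matrix.vecCons p.1 p.2) (fun A _ => (A 0, fun i => A i.succ))
    ?_ ?_ ?_ ?_ ?_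
  · intro p hp
    simpa [Fin.forall_fin_succ] using hp
  · intro A hA
    simp only [Fintype.mem_piFinset] at hA
    simp [hA]
  · intro p _
    simp
  · intro A _
    ext i
    refine Fin.cases ?_ (fun i => ?_) i <;> simp
  · intro p _
    rfl

theorem sum_piFinset_zero {α : Type*} (s : Finset α) (F : (Fin 0 → α) → ℕ) :
    ∑ A ∈ Fintype.piFinset (fun _ : Fin 0 => s), F A = F ![] := by
  rw [Fintype.piFinset_of_isEmpty, Finset.univ_unique, Finset.sum_singleton]
  congr

open Classical in
theorem ncard_eq_sum (P : Matrix (Fin m) (Fin m) ℕ → Prop) (hP : ∀ A, P A → ∀ i, ∑ j, A i j = k) :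
    {A | P A}.ncard = ∑ A ∈ Fintype.piFinset fun _ : Fin m => Finset.Nat.antidiagonalTuple m k,
      if P (Matrix.of A) then 1 else 0 := by
  rw [← Finset.card_filter, ← Set.ncard_coe_finset]
  congr 1
  ext A
  simp only [Set.mem_ofPred_eq, coe_filter, Fintype.mem_piFinset,
    Finset.Nat.mem_antidiagonalTuple]
  exact ⟨fun h => ⟨hP A h, h⟩, fun h => h.2⟩

theorem numRowSumMatrices_eq (m k : ℕ) :
    numRowSumMatrices m k = #(Finset.Nat.antidiagonalTuple m k) ^ m := by
  classical
  rw [numRowSumMatrices, ncard_eq_sum (k := k) _ fun _ h => h]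
  trans ∑ _A ∈ Fintype.piFinset fun _ : Fin m => Finset.Nat.antidiagonalTuple m k, 1
  · refine Finset.sum_congr rfl fun A hA => if_pos ?_
    simpa [Finset.Nat.mem_antidiagonalTuple] using hA
  · simp

/-! Boolean and arithmetic operations in the form that the kernel evaluates fastest. -/

/-- Conjunction that evaluates its second argument only if needed. -/
noncomputable def andThen (a b : Bool) : Bool := @Bool.rec (fun _ => Bool) false b a

/-- Implication that evaluates its conclusion only if needed. -/
noncomputable def impThen (a b : Bool) : Bool := @Bool.rec (fun _ => Bool) true b a

/-- The number `x` if `b` is true and zero otherwise. -/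
noncomputable def gate (b : Bool) (x : ℕ) : ℕ := @Bool.rec (fun _ => ℕ) 0 x b

/-- Evaluation of `f` at the truth value of `a = 0`. -/
noncomputable def splitZero {α : Type} (a : ℕ) (f : Bool → α) : α :=
  @Nat.rec (fun _ => α) (f true) (fun _ _ => f false) a

/-- Evaluation of `f` at a numeral instead of an unevaluated expression. -/
noncomputable def force {α : Type} (a : ℕ) (f : ℕ → α) : α :=
  @Nat.rec (fun _ => α) (f 0) (fun a _ => @Nat.rec (fun _ => α) (f 1) (fun a _ =>
    @Nat.rec (fun _ => α) (f 2) (fun a _ => @Nat.rec (fun _ => α) (f 3) (fun a _ =>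
    @Nat.rec (fun _ => α) (f 4) (fun a _ => @Nat.rec (fun _ => α) (f 5) (fun a _ =>
    f (a + 6)) a) a) a) a) a) a

/-- The sum of the values of `f` on a list. -/
noncomputable def listSum {α : Type} (l : List α) (f : α → ℕ) : ℕ :=
  @List.rec α (fun _ => ℕ) 0 (fun r _ s => Nat.add (f r) s) l

/-- The truth value of `a ≠ b`. -/
noncomputable def neTest (a b : ℕ) : Bool := @Bool.rec (fun _ => Bool) true false (Nat.beq a b)

/-- The test for `f` to be true on all members of a list. -/
noncomputable def allTest {α : Type} (l : List α) (f : α → Bool) : Bool :=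
  @List.rec α (fun _ => Bool) true (fun r _ s => andThen (f r) s) l

/-- The test for `f` to be true on all pairs of members of a list in their order. -/
noncomputable def pairwiseTest {α : Type} (l : List α) (f : α → α → Bool) : Bool :=
  @List.rec α (fun _ => Bool) true (fun r l s => andThen (allTest l (f r)) s) l

@[simp] theorem andThen_eq (a b : Bool) : (andThen a b = true) ↔ a = true ∧ b = true := by
  cases a <;> simp [andThen]

@[simp] theorem impThen_eq (a b : Bool) : (impThen a b = true) ↔ (a = true → b = true) := by
  cases a <;> simp [impThen]

theorem neTest_eq (a b : ℕ) : neTest a b = true ↔ a ≠ b := by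
  rw [ne_eq, ← Nat.beq_eq]
  unfold neTest
  cases Nat.beq a b <;> simp

theorem allTest_eq {α : Type} (l : List α) (f : α → Bool) :
    allTest l f = true ↔ ∀ r ∈ l, f r = true := by
  induction l with
  | nil => simp [allTest]
  | cons r l ih => rw [List.forall_mem_cons, ← ih]; exact andThen_eq _ _

theorem pairwiseTest_eq {α : Type} (l : List α) (f : α → α → Bool) :
    pairwiseTest l f = true ↔ l.Pairwise fun r s => f r s = true := by
  induction l with
  | nil => simp [pairwiseTest]
  | cons r l ih => rw [List.pairwise_cons, ← ih, ← allTest_eq]; exact andThen_eq _ _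

theorem gate_eq (b : Bool) (x : ℕ) : gate b x = if b = true then x else 0 := by
  cases b <;> rfl

theorem splitZero_eq {α : Type} (a : ℕ) (f : Bool → α) : splitZero a f = f (decide (a = 0)) := by
  cases a <;> rfl

theorem force_eq {α : Type} (a : ℕ) (f : ℕ → α) : force a f = f a := by
  rcases a with _ | _ | _ | _ | _ | _ | a <;> rfl

theorem listSum_eq {α : Type} (l : List α) (f : α → ℕ) : listSum l f = (l.map f).sum := by
  induction l with
  | nil => rfl
  | cons r l ih => rw [List.map_cons, List.sum_cons, ← ih]; rfl

theorem listSum_antidiagonalTuple (m k : ℕ) (f : (Fin m → ℕ) → ℕ) :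
    listSum (List.Nat.antidiagonalTuple m k) f = ∑ r ∈ Finset.Nat.antidiagonalTuple m k, f r :=
  listSum_eq _ _

theorem listSum_map {α β : Type} (l : List α) (g : α → β) (f : β → ℕ) :
    listSum (l.map g) f = listSum l fun r => f (g r) := by
  simp [listSum_eq, Function.comp_def]

theorem listSum_filter {α : Type} (l : List α) (p : α → Bool) (f : α → ℕ) :
    listSum (l.filter p) f = listSum l fun r => if p r = true then f r else 0 := by
  simp only [listSum_eq]
  induction l with
  | nil => rfl
  | cons r l ih => by_cases h : p r = true <;> simp [h, ih]

/-- The number with last octal digit `a` and remaining digits given by `x`. -/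
def octalCons (a x : ℕ) : ℕ := Nat.add a (Nat.mul 8 x)

theorem octalCons_inj {a b x y : ℕ} (ha : a < 8) (hb : b < 8)
    (h : octalCons a x = octalCons b y) : a = b ∧ x = y := by
  simp only [octalCons, Nat.add_eq, Nat.mul_eq] at h
  omega

/-! ### Four colors -/

/-- The weighted number of spanning trees directed to the root `0` of the complete graph on four
vertices; `bᵢ` is the weight of the arc from `i` to `0` and `aᵢⱼ` the weight of the arc from `i`
to `j`. -/
def treeWeight (b1 b2 b3 a12 a13 a21 a23 a31 a32 : ℕ) : ℕ :=
  Nat.add (Nat.add (Nat.mul b3 (Nat.add (Nat.mul b1 b2) (Nat.add (Nat.mul b1 (Nat.add a21 a23))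
    (Nat.mul b2 (Nat.add a12 a13))))) (Nat.mul (Nat.mul b1 b2) (Nat.add a31 a32)))
    (Nat.add (Nat.mul b1 (Nat.add (Nat.mul a21 (Nat.add a31 a32)) (Nat.mul a31 a23)))
    (Nat.add (Nat.mul b2 (Nat.add (Nat.mul a12 (Nat.add a31 a32)) (Nat.mul a32 a13)))
    (Nat.mul b3 (Nat.add (Nat.mul a13 (Nat.add a21 a23)) (Nat.mul a12 a23)))))

theorem treeWeight_mul (x y z b1 b2 b3 a12 a13 a21 a23 a31 a32 : ℕ) :
    treeWeight (x * b1) (y * b2) (z * b3) (x * a12) (x * a13) (y * a21) (y * a23) (z * a31)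
      (z * a32) = x * y * z * treeWeight b1 b2 b3 a12 a13 a21 a23 a31 a32 := by
  simp only [treeWeight, Nat.add_eq, Nat.mul_eq]
  ring

set_option synthInstance.maxHeartbeats 200000 in
set_option synthInstance.maxSize 2000 in
theorem treeWeight_ne_zero_iff {b1 b2 b3 a12 a13 a21 a23 a31 a32 : ℕ} (h12 : a12 = 0 ↔ a21 = 0)
    (h13 : a13 = 0 ↔ a31 = 0) (h23 : a23 = 0 ↔ a32 = 0) :
    treeWeight b1 b2 b3 a12 a13 a21 a23 a31 a32 ≠ 0 ↔ ∀ g0 g1 g2 g3 : Bool,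
      (b1 ≠ 0 → g0 = g1) → (b2 ≠ 0 → g0 = g2) → (b3 ≠ 0 → g0 = g3) → (a12 ≠ 0 → g1 = g2) →
      (a13 ≠ 0 → g1 = g3) → (a23 ≠ 0 → g2 = g3) → g0 = g1 ∧ g0 = g2 ∧ g0 = g3 := by
  have key : ∀ p1 p2 p3 p12 p13 p23 : Bool,
      ¬((((p3 = true ∨ ((p1 = true ∨ p2 = true) ∧ (p1 = true ∨ (p12 = true ∧ p23 = true)) ∧
        (p2 = true ∨ (p12 = true ∧ p13 = true)))) ∧
        ((p1 = true ∨ p2 = true) ∨ (p13 = true ∧ p23 = true))) ∧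
        ((p1 = true ∨ ((p12 = true ∨ (p13 = true ∧ p23 = true)) ∧ (p13 = true ∨ p23 = true))) ∧
        ((p2 = true ∨ ((p12 = true ∨ (p13 = true ∧ p23 = true)) ∧ (p23 = true ∨ p13 = true))) ∧
        (p3 = true ∨ ((p13 = true ∨ (p12 = true ∧ p23 = true)) ∧ (p12 = true ∨ p23 = true))))))) ↔
      ∀ g0 g1 g2 g3 : Bool, (¬ p1 = true → g0 = g1) → (¬ p2 = true → g0 = g2) →
        (¬ p3 = true → g0 = g3) → (¬ p12 = true → g1 = g2) → (¬ p13 = true → g1 = g3) →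
        (¬ p23 = true → g2 = g3) → g0 = g1 ∧ g0 = g2 ∧ g0 = g3 := by
    decide +kernel
  have := key (decide (b1 = 0)) (decide (b2 = 0)) (decide (b3 = 0)) (decide (a12 = 0))
    (decide (a13 = 0)) (decide (a23 = 0))
  simp only [decide_eq_true_eq] at this
  simpa only [treeWeight, Nat.add_eq, Nat.mul_eq, Nat.add_eq_zero_iff, Nat.mul_eq_zero, ← h12,
    ← h13, ← h23, ne_eq] using this

/-- The test for detailed balance of a `4 × 4` matrix with respect to given weights. -/
noncomputable def balanceTest (a01 a02 a03 a10 a12 a13 a20 a21 a23 a30 a31 a32 w0 w1 w2 w3 : ℕ) :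
    Bool :=
  andThen (Nat.ble 1 w0) <| andThen (Nat.ble 1 w1) <| andThen (Nat.ble 1 w2) <|
  andThen (Nat.ble 1 w3) <| andThen (Nat.beq (Nat.mul w0 a01) (Nat.mul w1 a10)) <|
  andThen (Nat.beq (Nat.mul w0 a02) (Nat.mul w2 a20)) <|
  andThen (Nat.beq (Nat.mul w0 a03) (Nat.mul w3 a30)) <|
  andThen (Nat.beq (Nat.mul w1 a12) (Nat.mul w2 a21)) <|
  andThen (Nat.beq (Nat.mul w1 a13) (Nat.mul w3 a31)) <| Nat.beq (Nat.mul w2 a23) (Nat.mul w3 a32)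

/-- The test for detailed balance and irreducibility of a `4 × 4` matrix, with the tree weights as
weights of the colors. -/
noncomputable def admissibleTest4 (a01 a02 a03 a10 a12 a13 a20 a21 a23 a30 a31 a32 : ℕ) : Bool :=
  balanceTest a01 a02 a03 a10 a12 a13 a20 a21 a23 a30 a31 a32
    (treeWeight a10 a20 a30 a12 a13 a21 a23 a31 a32)
    (treeWeight a01 a21 a31 a02 a03 a20 a23 a30 a32)
    (treeWeight a02 a12 a32 a01 a03 a10 a13 a30 a31)
    (treeWeight a03 a13 a23 a01 a02 a10 a12 a20 a21)

theorem eq_zero_iff_of_mul_eq {u v a b : ℕ} (hu : 0 < u) (hv : 0 < v) (h : u * a = v * b) :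
    a = 0 ↔ b = 0 := by
  constructor
  · rintro rfl
    simpa [hv.ne'] using h.symm
  · rintro rfl
    simpa [hu.ne'] using h

theorem mul_eq_mul_of_mul_eq {T U a b c t u v : ℕ} (hu : 0 < u) (hv : 0 < v) (hc : 0 < c)
    (hT : c * v * T = t) (hU : c * u * U = t) (h : u * a = v * b) : T * a = U * b := by
  refine Nat.eq_of_mul_eq_mul_left (Nat.mul_pos hc (Nat.mul_pos hu hv)) ?_
  calc c * (u * v) * (T * a) = (c * v * T) * (u * a) := by ring
    _ = (c * u * U) * (v * b) := by rw [hT, hU, h]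
    _ = _ := by ring

theorem admissibleTest4_iff (A : Matrix (Fin 4) (Fin 4) ℕ) :
    admissibleTest4 (A 0 1) (A 0 2) (A 0 3) (A 1 0) (A 1 2) (A 1 3) (A 2 0) (A 2 1) (A 2 3) (A 3 0)
      (A 3 1) (A 3 2) = true ↔
    (∃ w : Fin 4 → ℕ, (∀ i, 0 < w i) ∧ ∀ i j, w i * A i j = w j * A j i) ∧
      ∀ f : Fin 4 → Bool, (∀ i j, A i j ≠ 0 → f i = f j) → ∀ i j, f i = f j := by
  simp only [admissibleTest4, balanceTest, andThen_eq, Nat.ble_eq, Nat.beq_eq, Nat.mul_eq]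
  constructor
  · rintro ⟨h0, h1, h2, h3, h01, h02, h03, h12, h13, h23⟩
    have e12 := eq_zero_iff_of_mul_eq h1 h2 h12
    have e13 := eq_zero_iff_of_mul_eq h1 h3 h13
    have e23 := eq_zero_iff_of_mul_eq h2 h3 h23
    have hconn := (treeWeight_ne_zero_iff e12 e13 e23).1 (Nat.pos_iff_ne_zero.1 h0)
    generalize treeWeight _ _ _ _ _ _ _ _ _ = w0 at *
    generalize treeWeight _ _ _ _ _ _ _ _ _ = w1 at *
    generalize treeWeight _ _ _ _ _ _ _ _ _ = w2 at *
    generalize treeWeight _ _ _ _ _ _ _ _ _ = w3 at *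
    refine ⟨⟨![w0, w1, w2, w3], ?_, ?_⟩, fun f hf => ?_⟩
    · simp only [Fin.forall_fin_succ]
      simp
      omega
    · simp only [Fin.forall_fin_succ]
      simp [h01, h02, h03, h12, h13, h23]
    · obtain ⟨g1, g2, g3⟩ := hconn (f 0) (f 1) (f 2) (f 3) (fun h => (hf 1 0 h).symm)
        (fun h => (hf 2 0 h).symm) (fun h => (hf 3 0 h).symm) (hf 1 2) (hf 1 3) (hf 2 3)
      have : ∀ i, f 0 = f i := by
        simp only [Fin.forall_fin_succ]
        simpa using ⟨g1, g2, g3⟩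
      exact fun i j => (this i).symm.trans (this j)
  · rintro ⟨⟨w, hw, hbal⟩, hirr⟩
    have hz : ∀ i j, A i j = 0 ↔ A j i = 0 := fun i j =>
      eq_zero_iff_of_mul_eq (hw i) (hw j) (hbal i j)
    have hg : ∀ f : Fin 4 → Bool, (A 0 1 ≠ 0 → f 0 = f 1) → (A 0 2 ≠ 0 → f 0 = f 2) →
        (A 0 3 ≠ 0 → f 0 = f 3) → (A 1 2 ≠ 0 → f 1 = f 2) → (A 1 3 ≠ 0 → f 1 = f 3) →
        (A 2 3 ≠ 0 → f 2 = f 3) → ∀ i j, f i = f j := by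
      intro f h01 h02 h03 h12 h13 h23
      refine hirr f ?_
      have h10 := fun h => (h01 ((hz 1 0).not.1 h)).symm
      have h20 := fun h => (h02 ((hz 2 0).not.1 h)).symm
      have h30 := fun h => (h03 ((hz 3 0).not.1 h)).symm
      have h21 := fun h => (h12 ((hz 2 1).not.1 h)).symm
      have h31 := fun h => (h13 ((hz 3 1).not.1 h)).symm
      have h32 := fun h => (h23 ((hz 3 2).not.1 h)).symm
      intro i j
      fin_cases i <;> fin_cases j <;> first | exact fun _ => rfl | assumption
    have hpos : ∀ {n : ℕ}, n ≠ 0 → 1 ≤ n := Nat.pos_of_ne_zero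
    set τ := treeWeight (w 0 * A 0 1) (w 0 * A 0 2) (w 0 * A 0 3) (w 1 * A 1 2) (w 1 * A 1 3)
      (w 1 * A 1 2) (w 2 * A 2 3) (w 1 * A 1 3) (w 2 * A 2 3) with hτ
    have t0 : w 1 * w 2 * w 3 * treeWeight (A 1 0) (A 2 0) (A 3 0) (A 1 2) (A 1 3) (A 2 1) (A 2 3)
        (A 3 1) (A 3 2) = τ := by
      rw [← treeWeight_mul, hbal 1 0, hbal 2 0, hbal 3 0, hbal 2 1, hbal 3 1, hbal 3 2]
    have t1 : w 0 * w 2 * w 3 * treeWeight (A 0 1) (A 2 1) (A 3 1) (A 0 2) (A 0 3) (A 2 0) (A 2 3)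
        (A 3 0) (A 3 2) = τ := by
      rw [← treeWeight_mul, hbal 2 0, hbal 3 0, hbal 2 1, hbal 3 1, hbal 3 2, hτ]
      simp only [treeWeight, Nat.add_eq, Nat.mul_eq]
      ring
    have t2 : w 0 * w 1 * w 3 * treeWeight (A 0 2) (A 1 2) (A 3 2) (A 0 1) (A 0 3) (A 1 0) (A 1 3)
        (A 3 0) (A 3 1) = τ := by
      rw [← treeWeight_mul, hbal 1 0, hbal 3 0, hbal 3 1, hbal 3 2, hτ]
      simp only [treeWeight, Nat.add_eq, Nat.mul_eq]
      ring
    have t3 : w 0 * w 1 * w 2 * treeWeight (A 0 3) (A 1 3) (A 2 3) (A 0 1) (A 0 2) (A 1 0) (A 1 2)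
        (A 2 0) (A 2 1) = τ := by
      rw [← treeWeight_mul, hbal 1 0, hbal 2 0, hbal 2 1, hτ]
      simp only [treeWeight, Nat.add_eq, Nat.mul_eq]
      ring
    have n0 : treeWeight (A 1 0) (A 2 0) (A 3 0) (A 1 2) (A 1 3) (A 2 1) (A 2 3) (A 3 1)
        (A 3 2) ≠ 0 := by
      refine (treeWeight_ne_zero_iff (hz _ _) (hz _ _) (hz _ _)).2 fun g0 g1 g2 g3 h1 h2 h3 h4 h5 h6 => ?_
      have := hg ![g0, g1, g2, g3] (fun h => h1 ((hz 1 0).not.2 h)) (fun h => h2 ((hz 2 0).not.2 h))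
        (fun h => h3 ((hz 3 0).not.2 h)) h4 h5 h6 0
      exact ⟨this 1, this 2, this 3⟩
    have hτ0 : τ ≠ 0 := by
      rw [← t0]
      have := hw 1; have := hw 2; have := hw 3
      positivity
    have hc : ∀ i j, 0 < w i * w j := fun i j => Nat.mul_pos (hw i) (hw j)
    refine ⟨hpos n0, hpos fun h => hτ0 ?_, hpos fun h => hτ0 ?_, hpos fun h => hτ0 ?_,
      mul_eq_mul_of_mul_eq (hw 0) (hw 1) (hc 2 3) (t := τ)
        (by linear_combination t0) (by linear_combination t1)
        (hbal 0 1),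
      mul_eq_mul_of_mul_eq (hw 0) (hw 2) (hc 1 3) (t := τ)
        (by linear_combination t0) (by linear_combination t2)
        (hbal 0 2),
      mul_eq_mul_of_mul_eq (hw 0) (hw 3) (hc 1 2) (t := τ)
        (by linear_combination t0) (by linear_combination t3)
        (hbal 0 3),
      mul_eq_mul_of_mul_eq (hw 1) (hw 2) (hc 0 3) (t := τ)
        (by linear_combination t1) (by linear_combination t2)
        (hbal 1 2),
      mul_eq_mul_of_mul_eq (hw 1) (hw 3) (hc 0 2) (t := τ)
        (by linear_combination t1) (by linear_combination t3)
        (hbal 1 3),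
      mul_eq_mul_of_mul_eq (hw 2) (hw 3) (hc 0 1) (t := τ)
        (by linear_combination t2) (by linear_combination t3)
        (hbal 2 3)⟩
    · rw [← t1, h, mul_zero]
    · rw [← t2, h, mul_zero]
    · rw [← t3, h, mul_zero]

/-- The number with the given octal digits, the last digit being the most significant one. -/
def octalCode (a00 a01 a02 a03 a10 a11 a12 a13 a20 a21 a22 a23 a30 a31 a32 a33 : ℕ) : ℕ :=
  octalCons a00 <| octalCons a01 <| octalCons a02 <| octalCons a03 <|
  octalCons a10 <| octalCons a11 <| octalCons a12 <| octalCons a13 <|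
  octalCons a20 <| octalCons a21 <| octalCons a22 <| octalCons a23 <|
  octalCons a30 <| octalCons a31 <| octalCons a32 a33

/-- The code of the matrix that arises from `A` by ordering the colors as `i, j, k, l`. -/
def permCode4 (A : Matrix (Fin 4) (Fin 4) ℕ) (i j k l : Fin 4) : ℕ :=
  octalCode (A i i) (A i j) (A i k) (A i l) (A j i) (A j j) (A j k) (A j l)
    (A k i) (A k j) (A k k) (A k l) (A l i) (A l j) (A l k) (A l l)

theorem permCode4_submatrix (A : Matrix (Fin 4) (Fin 4) ℕ) (f : Fin 4 → Fin 4) (i j k l : Fin 4) :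
    permCode4 (A.submatrix f f) i j k l = permCode4 A (f i) (f j) (f k) (f l) := by
  simp only [permCode4, Matrix.submatrix_apply]

theorem permCode4_injective {A B : Matrix (Fin 4) (Fin 4) ℕ} (hA : ∀ i j, A i j < 8)
    (hB : ∀ i j, B i j < 8) (h : permCode4 A 0 1 2 3 = permCode4 B 0 1 2 3) : A = B := by
  simp only [permCode4, octalCode] at h
  replace h := octalCons_inj (hA 0 0) (hB 0 0) h
  obtain ⟨h00, h⟩ := h
  replace h := octalCons_inj (hA 0 1) (hB 0 1) h
  obtain ⟨h01, h⟩ := h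
  replace h := octalCons_inj (hA 0 2) (hB 0 2) h
  obtain ⟨h02, h⟩ := h
  replace h := octalCons_inj (hA 0 3) (hB 0 3) h
  obtain ⟨h03, h⟩ := h
  replace h := octalCons_inj (hA 1 0) (hB 1 0) h
  obtain ⟨h10, h⟩ := h
  replace h := octalCons_inj (hA 1 1) (hB 1 1) h
  obtain ⟨h11, h⟩ := h
  replace h := octalCons_inj (hA 1 2) (hB 1 2) h
  obtain ⟨h12, h⟩ := h
  replace h := octalCons_inj (hA 1 3) (hB 1 3) h
  obtain ⟨h13, h⟩ := h
  replace h := octalCons_inj (hA 2 0) (hB 2 0) h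
  obtain ⟨h20, h⟩ := h
  replace h := octalCons_inj (hA 2 1) (hB 2 1) h
  obtain ⟨h21, h⟩ := h
  replace h := octalCons_inj (hA 2 2) (hB 2 2) h
  obtain ⟨h22, h⟩ := h
  replace h := octalCons_inj (hA 2 3) (hB 2 3) h
  obtain ⟨h23, h⟩ := h
  replace h := octalCons_inj (hA 3 0) (hB 3 0) h
  obtain ⟨h30, h⟩ := h
  replace h := octalCons_inj (hA 3 1) (hB 3 1) h
  obtain ⟨h31, h⟩ := h
  replace h := octalCons_inj (hA 3 2) (hB 3 2) h
  obtain ⟨h32, h⟩ := h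
  ext i j
  fin_cases i <;> fin_cases j <;> assumption

attribute [local irreducible] octalCode

/-- The last step of `canonicalTest4`. -/
noncomputable def lastTest4 (A : Matrix (Fin 4) (Fin 4) ℕ) (i j k l : Fin 4) : Bool :=
  impThen (Nat.beq (A k k) (A 2 2)) <| impThen (Nat.beq (A l l) (A 3 3)) <|
    Nat.ble (permCode4 A 0 1 2 3) (permCode4 A i j k l)

/-- The middle step of `canonicalTest4`. -/
noncomputable def middleTest4 (A : Matrix (Fin 4) (Fin 4) ℕ) (i j k l : Fin 4) : Bool :=
  impThen (Nat.beq (A j j) (A 1 1)) <| andThen (lastTest4 A i j k l) (lastTest4 A i j l k)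

/-- The first step of `canonicalTest4`. -/
noncomputable def firstTest4 (A : Matrix (Fin 4) (Fin 4) ℕ) (i j k l : Fin 4) : Bool :=
  impThen (Nat.beq (A i i) (A 0 0)) <| andThen (middleTest4 A i j k l) <|
    andThen (middleTest4 A i k j l) (middleTest4 A i l j k)

/-- The test for minimality of the code among all permutations that preserve the diagonal. -/
noncomputable def canonicalTest4 (A : Matrix (Fin 4) (Fin 4) ℕ) : Bool :=
  andThen (firstTest4 A 0 1 2 3) <| andThen (firstTest4 A 1 0 2 3) <|
    andThen (firstTest4 A 2 0 1 3) (firstTest4 A 3 0 1 2)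

/-- The values of all permutations of four colors. -/
def perms4 : List (Fin 4 × Fin 4 × Fin 4 × Fin 4) :=
  [(0, 1, 2, 3), (0, 1, 3, 2), (0, 2, 1, 3), (0, 2, 3, 1), (0, 3, 1, 2), (0, 3, 2, 1),
    (1, 0, 2, 3), (1, 0, 3, 2), (1, 2, 0, 3), (1, 2, 3, 0), (1, 3, 0, 2), (1, 3, 2, 0),
    (2, 0, 1, 3), (2, 0, 3, 1), (2, 1, 0, 3), (2, 1, 3, 0), (2, 3, 0, 1), (2, 3, 1, 0),
    (3, 0, 1, 2), (3, 0, 2, 1), (3, 1, 0, 2), (3, 1, 2, 0), (3, 2, 0, 1), (3, 2, 1, 0)]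

theorem mem_perms4 (σ : Equiv.Perm (Fin 4)) : (σ 0, σ 1, σ 2, σ 3) ∈ perms4 := by
  revert σ
  decide +kernel

theorem exists_of_mem_perms4 : ∀ p ∈ perms4, ∃ σ : Equiv.Perm (Fin 4), (σ 0, σ 1, σ 2, σ 3) = p := by
  decide +kernel

theorem canonicalTest4_iff_forall_mem (A : Matrix (Fin 4) (Fin 4) ℕ) :
    canonicalTest4 A = true ↔ ∀ p ∈ perms4, A p.1 p.1 = A 0 0 → A p.2.1 p.2.1 = A 1 1 →
      A p.2.2.1 p.2.2.1 = A 2 2 → A p.2.2.2 p.2.2.2 = A 3 3 →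
      permCode4 A 0 1 2 3 ≤ permCode4 A p.1 p.2.1 p.2.2.1 p.2.2.2 := by
  simp only [canonicalTest4, firstTest4, middleTest4, lastTest4, andThen_eq, impThen_eq,
    Nat.beq_eq, Nat.ble_eq, perms4, List.forall_mem_cons, List.not_mem_nil, false_imp_iff,
    implies_true, and_true, imp_and, and_assoc]

theorem canonicalTest4_iff (A : Matrix (Fin 4) (Fin 4) ℕ) :
    canonicalTest4 A = true ↔ ∀ σ : Equiv.Perm (Fin 4), (∀ i, A (σ i) (σ i) = A i i) →
      permCode4 A 0 1 2 3 ≤ permCode4 (A.submatrix σ σ) 0 1 2 3 := by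
  simp only [permCode4_submatrix]
  rw [canonicalTest4_iff_forall_mem]
  constructor
  · intro H σ hσ
    exact H _ (mem_perms4 σ) (hσ 0) (hσ 1) (hσ 2) (hσ 3)
  · intro H p hp h0 h1 h2 h3
    obtain ⟨σ, rfl⟩ := exists_of_mem_perms4 p hp
    refine H σ fun i => ?_
    fin_cases i <;> assumption

/-- The vector with the given entries. -/
noncomputable def vec4 {α : Type} (r0 r1 r2 r3 : α) (i : Fin 4) : α :=
  @Nat.rec (fun _ => α) r0 (fun n _ => @Nat.rec (fun _ => α) r1
    (fun n _ => @Nat.rec (fun _ => α) r2 (fun _ _ => r3) n) n) i.1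

theorem vec4_eq {α : Type} (a b c d : α) : vec4 a b c d = ![a, b, c, d] := by
  ext i
  fin_cases i <;> rfl

/-- The rows of length four with sum `k`. -/
noncomputable def rows4 (k : ℕ) : List (ℕ × ℕ × ℕ × ℕ) :=
  (List.Nat.antidiagonalTuple 4 k).map fun r => force (r 0) fun a => force (r 1) fun b =>
    force (r 2) fun c => force (r 3) fun d => (a, b, c, d)

/-- Equality of truth values. -/
noncomputable def sameTruth (a b : Bool) : Bool :=
  @Bool.rec (fun _ => Bool) (@Bool.rec (fun _ => Bool) true false b) b a

theorem sameTruth_eq (a b : ℕ) :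
    sameTruth (Nat.beq a 0) (decide (b = 0)) = true ↔ (a = 0 ↔ b = 0) := by
  cases a <;> cases b <;> simp [sameTruth, Nat.beq]

/-- The rows whose first entry is zero or not as prescribed. -/
noncomputable def rows4₁ (k : ℕ) (x : Bool) : List (ℕ × ℕ × ℕ × ℕ) :=
  (rows4 k).filter fun r => sameTruth (Nat.beq r.1 0) x

/-- The rows whose first two entries are zero or not as prescribed. -/
noncomputable def rows4₂ (k : ℕ) (x y : Bool) : List (ℕ × ℕ × ℕ × ℕ) :=
  (rows4₁ k x).filter fun r => sameTruth (Nat.beq r.2.1 0) y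

/-- The rows whose first three entries are zero or not as prescribed. -/
noncomputable def rows4₃ (k : ℕ) (x y z : Bool) : List (ℕ × ℕ × ℕ × ℕ) :=
  (rows4₂ k x y).filter fun r => sameTruth (Nat.beq r.2.2.1 0) z

/-- The sum of the values of `f` on a list of rows. -/
noncomputable def rowSum4 (l : List (ℕ × ℕ × ℕ × ℕ)) (f : ℕ → ℕ → ℕ → ℕ → ℕ) : ℕ :=
  listSum l fun r => @Prod.rec _ _ (fun _ => ℕ) (fun a r => @Prod.rec _ _ (fun _ => ℕ)
    (fun b r => @Prod.rec _ _ (fun _ => ℕ) (fun c d => f a b c d) r) r) r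

/-- The number of canonical admissible matrices with four given rows: zero or one. -/
noncomputable def count4₄ (a00 a01 a02 a03 a10 a11 a12 a13 a20 a21 a22 a23 a30 a31 a32 a33 : ℕ) :
    ℕ :=
  gate (Nat.ble a22 a33) <|
  gate (Nat.beq (Nat.mul (Nat.mul a01 a13) a30) (Nat.mul (Nat.mul a03 a31) a10)) <|
  gate (Nat.beq (Nat.mul (Nat.mul a02 a23) a30) (Nat.mul (Nat.mul a03 a32) a20)) <|
  gate (Nat.beq (Nat.mul (Nat.mul a12 a23) a31) (Nat.mul (Nat.mul a13 a32) a21)) <|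
  gate (admissibleTest4 a01 a02 a03 a10 a12 a13 a20 a21 a23 a30 a31 a32) <|
  gate (canonicalTest4 (vec4 (vec4 a00 a01 a02 a03) (vec4 a10 a11 a12 a13) (vec4 a20 a21 a22 a23)
    (vec4 a30 a31 a32 a33))) 1

/-- The number of canonical admissible matrices with three given rows. -/
noncomputable def count4₃ (k a00 a01 a02 a03 a10 a11 a12 a13 a20 a21 a22 a23 : ℕ) : ℕ :=
  gate (Nat.ble a11 a22) <|
  gate (Nat.beq (Nat.mul (Nat.mul a01 a12) a20) (Nat.mul (Nat.mul a02 a21) a10)) <|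
  rowSum4 (splitZero a03 fun x => splitZero a13 fun y => splitZero a23 fun z => rows4₃ k x y z) <|
  count4₄ a00 a01 a02 a03 a10 a11 a12 a13 a20 a21 a22 a23

/-- The number of canonical admissible matrices with two given rows. -/
noncomputable def count4₂ (k a00 a01 a02 a03 a10 a11 a12 a13 : ℕ) : ℕ :=
  gate (Nat.ble a00 a11) <|
  rowSum4 (splitZero a02 fun x => splitZero a12 fun y => rows4₂ k x y) <|
  count4₃ k a00 a01 a02 a03 a10 a11 a12 a13

/-- The number of canonical admissible matrices with a given first row. -/
noncomputable def count4₁ (k a00 a01 a02 a03 : ℕ) : ℕ :=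
  rowSum4 (splitZero a01 fun x => rows4₁ k x) <| count4₂ k a00 a01 a02 a03

/-- The number of canonical admissible `4 × 4` matrices. -/
noncomputable def count4 (k : ℕ) : ℕ := rowSum4 (rows4 k) (count4₁ k)

theorem rowSum4_rows4 (k : ℕ) (f : ℕ → ℕ → ℕ → ℕ → ℕ) : rowSum4 (rows4 k) f =
    ∑ r ∈ Finset.Nat.antidiagonalTuple 4 k, f (r 0) (r 1) (r 2) (r 3) := by
  simp only [rowSum4, rows4, force_eq, listSum_map, listSum_antidiagonalTuple]

theorem rowSum4_filter (l : List (ℕ × ℕ × ℕ × ℕ)) (p : ℕ × ℕ × ℕ × ℕ → Bool)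
    (f : ℕ → ℕ → ℕ → ℕ → ℕ) : rowSum4 (l.filter p) f =
      rowSum4 l fun a b c d => if p (a, b, c, d) = true then f a b c d else 0 := by
  rw [rowSum4, listSum_filter]
  rfl

theorem ite_sum {α : Type*} (s : Finset α) (p : Prop) [Decidable p] (f : α → ℕ) :
    (if p then ∑ r ∈ s, f r else 0) = ∑ r ∈ s, if p then f r else 0 := by
  split_ifs <;> simp

theorem triangle_of_balanced {x y z a b c d e f : ℕ} (hx : 0 < x) (hy : 0 < y) (hz : 0 < z)
    (h1 : x * a = y * b) (h2 : y * c = z * d) (h3 : x * e = z * f) :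
    a * c * f = e * d * b := by
  refine Nat.eq_of_mul_eq_mul_left (Nat.mul_pos hx (Nat.mul_pos hy hz)) ?_
  calc x * (y * z) * (a * c * f) = (x * a) * (y * c) * (z * f) := by ring
    _ = (y * b) * (z * d) * (x * e) := by rw [h1, h2, ← h3]
    _ = _ := by ring

theorem isAdmissible_and_isCanonical4_iff {k : ℕ} {A : Matrix (Fin 4) (Fin 4) ℕ}
    (hrow : ∀ i, ∑ j, A i j = k) :
    (IsAdmissible k A ∧ IsCanonical (fun A => permCode4 A 0 1 2 3) A) ↔
      (A 1 0 = 0 ↔ A 0 1 = 0) ∧ A 0 0 ≤ A 1 1 ∧ (A 2 0 = 0 ↔ A 0 2 = 0) ∧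
      (A 2 1 = 0 ↔ A 1 2 = 0) ∧ A 1 1 ≤ A 2 2 ∧
      Nat.mul (Nat.mul (A 0 1) (A 1 2)) (A 2 0) = Nat.mul (Nat.mul (A 0 2) (A 2 1)) (A 1 0) ∧
      (A 3 0 = 0 ↔ A 0 3 = 0) ∧ (A 3 1 = 0 ↔ A 1 3 = 0) ∧ (A 3 2 = 0 ↔ A 2 3 = 0) ∧
      A 2 2 ≤ A 3 3 ∧
      Nat.mul (Nat.mul (A 0 1) (A 1 3)) (A 3 0) = Nat.mul (Nat.mul (A 0 3) (A 3 1)) (A 1 0) ∧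
      Nat.mul (Nat.mul (A 0 2) (A 2 3)) (A 3 0) = Nat.mul (Nat.mul (A 0 3) (A 3 2)) (A 2 0) ∧
      Nat.mul (Nat.mul (A 1 2) (A 2 3)) (A 3 1) = Nat.mul (Nat.mul (A 1 3) (A 3 2)) (A 2 1) ∧
      admissibleTest4 (A 0 1) (A 0 2) (A 0 3) (A 1 0) (A 1 2) (A 1 3) (A 2 0) (A 2 1) (A 2 3)
        (A 3 0) (A 3 1) (A 3 2) = true ∧ canonicalTest4 A = true := by
  rw [admissibleTest4_iff, canonicalTest4_iff]
  constructor
  · rintro ⟨hA, hA'⟩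
    obtain ⟨w, hw, hbal⟩ := hA.balanced
    have hz : ∀ i j, A i j = 0 ↔ A j i = 0 := fun i j =>
      eq_zero_iff_of_mul_eq (hw i) (hw j) (hbal i j)
    have ht : ∀ i j l, Nat.mul (Nat.mul (A i j) (A j l)) (A l i) =
        Nat.mul (Nat.mul (A i l) (A l j)) (A j i) := fun i j l =>
      triangle_of_balanced (hw i) (hw j) (hw l) (hbal i j) (hbal j l) (hbal i l)
    have hm : ∀ i j, i ≤ j → A i i ≤ A j j := fun i j hij => hA'.monotone hij
    exact ⟨hz _ _, hm _ _ (by decide), hz _ _, hz _ _, hm _ _ (by decide), ht _ _ _, hz _ _,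
      hz _ _, hz _ _, hm _ _ (by decide), ht _ _ _, ht _ _ _, ht _ _ _,
      ⟨hA.balanced, hA.irreducible⟩, hA'.code_le⟩
  · rintro ⟨-, h01, -, -, h12, -, -, -, -, h23, -, -, -, ⟨hbal, hirr⟩, hcode⟩
    refine ⟨⟨hrow, hbal, hirr⟩, ?_, hcode⟩
    rw [Fin.monotone_iff_le_succ]
    simp only [Fin.forall_fin_succ, IsEmpty.forall_iff, and_true]
    exact ⟨h01, h12, h23⟩

theorem ncard_eq_count4 (k : ℕ) :
    {A : Matrix (Fin 4) (Fin 4) ℕ | IsAdmissible k A ∧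
      IsCanonical (fun A => permCode4 A 0 1 2 3) A}.ncard = count4 k := by
  classical
  rw [ncard_eq_sum (k := k) _ fun A h => h.1.row_sum]
  simp only [sum_piFinset_succ, sum_piFinset_zero]
  simp only [count4, count4₁, count4₂, count4₃, count4₄, rowSum4_rows4, rowSum4_filter, rows4₁,
    rows4₂, rows4₃, splitZero_eq, gate_eq, sameTruth_eq, ite_sum, Nat.beq_eq, Nat.ble_eq, vec4_eq]
  refine Finset.sum_congr rfl fun r0 h0 => Finset.sum_congr rfl fun r1 h1 =>
    Finset.sum_congr rfl fun r2 h2 => Finset.sum_congr rfl fun r3 h3 => ?_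
  have he : ![![r0 0, r0 1, r0 2, r0 3], ![r1 0, r1 1, r1 2, r1 3], ![r2 0, r2 1, r2 2, r2 3],
      ![r3 0, r3 1, r3 2, r3 3]] = Matrix.of ![r0, r1, r2, r3] := by
    ext i j
    fin_cases i <;> fin_cases j <;> rfl
  rw [he]
  rw [Finset.Nat.mem_antidiagonalTuple] at h0 h1 h2 h3
  have hiff := isAdmissible_and_isCanonical4_iff (k := k) (A := Matrix.of ![r0, r1, r2, r3])
    (by simpa [Fin.forall_fin_succ] using ⟨h0, h1, h2, h3⟩)
  simp only [← ite_and]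
  split_ifs with hT hC hC
  · rfl
  · exact absurd (hiff.1 hT) hC
  · exact absurd (hiff.2 hC) hT
  · rfl

theorem numColorAdjacencyMatrices_four {k : ℕ} (hk : k < 8) :
    numColorAdjacencyMatrices 4 k = count4 k := by
  rw [← ncard_eq_count4]
  exact numColorAdjacencyMatrices_eq_ncard _ fun A B hA hB h => permCode4_injective
    (fun i j => (hA i j).trans_lt hk) (fun i j => (hB i j).trans_lt hk) h

set_option maxRecDepth 100000 in
theorem count4_three : count4 3 = 72 := Nat.eq_of_beq_eq_true (by decide +kernel)

set_option maxRecDepth 100000 in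
theorem count4_four : count4 4 = 485 := Nat.eq_of_beq_eq_true (by decide +kernel)

set_option maxRecDepth 100000 in
theorem count4_five : count4 5 = 2042 := Nat.eq_of_beq_eq_true (by decide +kernel)

/-! ### Three colors -/

/-- The weighted number of spanning trees directed to the root `0` of the complete graph on three
vertices; `bᵢ` is the weight of the arc from `i` to `0` and `aᵢⱼ` the weight of the arc from `i`
to `j`. -/
def treeWeight3 (b1 b2 a12 a21 : ℕ) : ℕ :=
  Nat.add (Nat.mul b1 b2) (Nat.add (Nat.mul b1 a21) (Nat.mul b2 a12))

theorem treeWeight3_mul (x y b1 b2 a12 a21 : ℕ) :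
    treeWeight3 (x * b1) (y * b2) (x * a12) (y * a21) = x * y * treeWeight3 b1 b2 a12 a21 := by
  simp only [treeWeight3, Nat.add_eq, Nat.mul_eq]
  ring

theorem treeWeight3_ne_zero_iff {b1 b2 a12 a21 : ℕ} (h12 : a12 = 0 ↔ a21 = 0) :
    treeWeight3 b1 b2 a12 a21 ≠ 0 ↔ ∀ g0 g1 g2 : Bool,
      (b1 ≠ 0 → g0 = g1) → (b2 ≠ 0 → g0 = g2) → (a12 ≠ 0 → g1 = g2) → g0 = g1 ∧ g0 = g2 := by
  have key : ∀ p1 p2 p12 : Bool,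
      ¬((p1 = true ∨ p2 = true) ∧ (p1 = true ∨ p12 = true) ∧ (p2 = true ∨ p12 = true)) ↔
      ∀ g0 g1 g2 : Bool, (¬ p1 = true → g0 = g1) → (¬ p2 = true → g0 = g2) →
        (¬ p12 = true → g1 = g2) → g0 = g1 ∧ g0 = g2 := by
    decide +kernel
  have := key (decide (b1 = 0)) (decide (b2 = 0)) (decide (a12 = 0))
  simp only [decide_eq_true_eq] at this
  simpa only [treeWeight3, Nat.add_eq, Nat.mul_eq, Nat.add_eq_zero_iff, Nat.mul_eq_zero, ← h12,
    ne_eq] using this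

/-- The test for detailed balance of a `3 × 3` matrix with respect to given weights. -/
noncomputable def balanceTest3 (a01 a02 a10 a12 a20 a21 w0 w1 w2 : ℕ) : Bool :=
  andThen (Nat.ble 1 w0) <| andThen (Nat.ble 1 w1) <| andThen (Nat.ble 1 w2) <|
  andThen (Nat.beq (Nat.mul w0 a01) (Nat.mul w1 a10)) <|
  andThen (Nat.beq (Nat.mul w0 a02) (Nat.mul w2 a20)) <| Nat.beq (Nat.mul w1 a12) (Nat.mul w2 a21)

/-- The test for detailed balance and irreducibility of a `3 × 3` matrix, with the tree weights as
weights of the colors. -/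
noncomputable def admissibleTest3 (a01 a02 a10 a12 a20 a21 : ℕ) : Bool :=
  balanceTest3 a01 a02 a10 a12 a20 a21
    (treeWeight3 a10 a20 a12 a21) (treeWeight3 a01 a21 a02 a20) (treeWeight3 a02 a12 a01 a10)

theorem admissibleTest3_iff (A : Matrix (Fin 3) (Fin 3) ℕ) :
    admissibleTest3 (A 0 1) (A 0 2) (A 1 0) (A 1 2) (A 2 0) (A 2 1) = true ↔
    (∃ w : Fin 3 → ℕ, (∀ i, 0 < w i) ∧ ∀ i j, w i * A i j = w j * A j i) ∧
      ∀ f : Fin 3 → Bool, (∀ i j, A i j ≠ 0 → f i = f j) → ∀ i j, f i = f j := by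
  simp only [admissibleTest3, balanceTest3, andThen_eq, Nat.ble_eq, Nat.beq_eq, Nat.mul_eq]
  constructor
  · rintro ⟨h0, h1, h2, h01, h02, h12⟩
    have hconn := (treeWeight3_ne_zero_iff (eq_zero_iff_of_mul_eq h1 h2 h12)).1
      (Nat.pos_iff_ne_zero.1 h0)
    generalize treeWeight3 _ _ _ _ = w0 at *
    generalize treeWeight3 _ _ _ _ = w1 at *
    generalize treeWeight3 _ _ _ _ = w2 at *
    refine ⟨⟨![w0, w1, w2], ?_, ?_⟩, fun f hf => ?_⟩
    · simp only [Fin.forall_fin_succ]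
      simp
      omega
    · simp only [Fin.forall_fin_succ]
      simp [h01, h02, h12]
    · obtain ⟨g1, g2⟩ := hconn (f 0) (f 1) (f 2) (fun h => (hf 1 0 h).symm)
        (fun h => (hf 2 0 h).symm) (hf 1 2)
      have : ∀ i, f 0 = f i := by
        simp only [Fin.forall_fin_succ]
        simpa using ⟨g1, g2⟩
      exact fun i j => (this i).symm.trans (this j)
  · rintro ⟨⟨w, hw, hbal⟩, hirr⟩
    have hz : ∀ i j, A i j = 0 ↔ A j i = 0 := fun i j =>
      eq_zero_iff_of_mul_eq (hw i) (hw j) (hbal i j)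
    have hg : ∀ f : Fin 3 → Bool, (A 0 1 ≠ 0 → f 0 = f 1) → (A 0 2 ≠ 0 → f 0 = f 2) →
        (A 1 2 ≠ 0 → f 1 = f 2) → ∀ i j, f i = f j := by
      intro f h01 h02 h12
      refine hirr f ?_
      have h10 := fun h => (h01 ((hz 1 0).not.1 h)).symm
      have h20 := fun h => (h02 ((hz 2 0).not.1 h)).symm
      have h21 := fun h => (h12 ((hz 2 1).not.1 h)).symm
      intro i j
      fin_cases i <;> fin_cases j <;> first | exact fun _ => rfl | assumption
    have hpos : ∀ {n : ℕ}, n ≠ 0 → 1 ≤ n := Nat.pos_of_ne_zero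
    set τ := treeWeight3 (w 0 * A 0 1) (w 0 * A 0 2) (w 1 * A 1 2) (w 1 * A 1 2) with hτ
    have t0 : w 1 * w 2 * treeWeight3 (A 1 0) (A 2 0) (A 1 2) (A 2 1) = τ := by
      rw [← treeWeight3_mul, hbal 1 0, hbal 2 0, hbal 2 1]
    have t1 : w 0 * w 2 * treeWeight3 (A 0 1) (A 2 1) (A 0 2) (A 2 0) = τ := by
      rw [← treeWeight3_mul, hbal 2 0, hbal 2 1, hτ]
      simp only [treeWeight3, Nat.add_eq, Nat.mul_eq]
      ring
    have t2 : w 0 * w 1 * treeWeight3 (A 0 2) (A 1 2) (A 0 1) (A 1 0) = τ := by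
      rw [← treeWeight3_mul, hbal 1 0, hτ]
      simp only [treeWeight3, Nat.add_eq, Nat.mul_eq]
      ring
    have n0 : treeWeight3 (A 1 0) (A 2 0) (A 1 2) (A 2 1) ≠ 0 := by
      refine (treeWeight3_ne_zero_iff (hz _ _)).2 fun g0 g1 g2 h1 h2 h3 => ?_
      have := hg ![g0, g1, g2] (fun h => h1 ((hz 1 0).not.2 h)) (fun h => h2 ((hz 2 0).not.2 h))
        h3 0
      exact ⟨this 1, this 2⟩
    have hτ0 : τ ≠ 0 := by
      rw [← t0]
      have := hw 1; have := hw 2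
      positivity
    refine ⟨hpos n0, hpos fun h => hτ0 ?_, hpos fun h => hτ0 ?_,
      mul_eq_mul_of_mul_eq (hw 0) (hw 1) (hw 2) (t := τ)
        (by linear_combination t0)
        (by linear_combination t1) (hbal 0 1),
      mul_eq_mul_of_mul_eq (hw 0) (hw 2) (hw 1) (t := τ)
        (by linear_combination t0)
        (by linear_combination t2) (hbal 0 2),
      mul_eq_mul_of_mul_eq (hw 1) (hw 2) (hw 0) (t := τ)
        (by linear_combination t1)
        (by linear_combination t2) (hbal 1 2)⟩
    · rw [← t1, h, mul_zero]
    · rw [← t2, h, mul_zero]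

/-- The code of the matrix that arises from `A` by ordering the colors as `i, j, k`. -/
def permCode3 (A : Matrix (Fin 3) (Fin 3) ℕ) (i j k : Fin 3) : ℕ :=
  octalCons (A i i) <| octalCons (A i j) <| octalCons (A i k) <|
  octalCons (A j i) <| octalCons (A j j) <| octalCons (A j k) <|
  octalCons (A k i) <| octalCons (A k j) (A k k)

theorem permCode3_submatrix (A : Matrix (Fin 3) (Fin 3) ℕ) (f : Fin 3 → Fin 3) (i j k : Fin 3) :
    permCode3 (A.submatrix f f) i j k = permCode3 A (f i) (f j) (f k) := by
  simp only [permCode3, Matrix.submatrix_apply]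

theorem permCode3_injective {A B : Matrix (Fin 3) (Fin 3) ℕ} (hA : ∀ i j, A i j < 8)
    (hB : ∀ i j, B i j < 8) (h : permCode3 A 0 1 2 = permCode3 B 0 1 2) : A = B := by
  simp only [permCode3] at h
  replace h := octalCons_inj (hA 0 0) (hB 0 0) h
  obtain ⟨h00, h⟩ := h
  replace h := octalCons_inj (hA 0 1) (hB 0 1) h
  obtain ⟨h01, h⟩ := h
  replace h := octalCons_inj (hA 0 2) (hB 0 2) h
  obtain ⟨h02, h⟩ := h
  replace h := octalCons_inj (hA 1 0) (hB 1 0) h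
  obtain ⟨h10, h⟩ := h
  replace h := octalCons_inj (hA 1 1) (hB 1 1) h
  obtain ⟨h11, h⟩ := h
  replace h := octalCons_inj (hA 1 2) (hB 1 2) h
  obtain ⟨h12, h⟩ := h
  replace h := octalCons_inj (hA 2 0) (hB 2 0) h
  obtain ⟨h20, h⟩ := h
  replace h := octalCons_inj (hA 2 1) (hB 2 1) h
  obtain ⟨h21, h⟩ := h
  ext i j
  fin_cases i <;> fin_cases j <;> assumption

attribute [local irreducible] octalCons

/-- The comparison of the code of `A` with the code for the order `i, j, k` of the colors. -/
noncomputable def orderTest3 (A : Matrix (Fin 3) (Fin 3) ℕ) (i j k : Fin 3) : Bool :=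
  impThen (Nat.beq (A i i) (A 0 0)) <| impThen (Nat.beq (A j j) (A 1 1)) <|
  impThen (Nat.beq (A k k) (A 2 2)) <| Nat.ble (permCode3 A 0 1 2) (permCode3 A i j k)

/-- The test for minimality of the code among all permutations that preserve the diagonal. -/
noncomputable def canonicalTest3 (A : Matrix (Fin 3) (Fin 3) ℕ) : Bool :=
  andThen (orderTest3 A 0 1 2) <| andThen (orderTest3 A 0 2 1) <| andThen (orderTest3 A 1 0 2) <|
  andThen (orderTest3 A 1 2 0) <| andThen (orderTest3 A 2 0 1) (orderTest3 A 2 1 0)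

/-- The values of all permutations of three colors. -/
def perms3 : List (Fin 3 × Fin 3 × Fin 3) :=
  [(0, 1, 2), (0, 2, 1), (1, 0, 2), (1, 2, 0), (2, 0, 1), (2, 1, 0)]

theorem mem_perms3 (σ : Equiv.Perm (Fin 3)) : (σ 0, σ 1, σ 2) ∈ perms3 := by
  revert σ
  decide +kernel

theorem exists_of_mem_perms3 : ∀ p ∈ perms3, ∃ σ : Equiv.Perm (Fin 3), (σ 0, σ 1, σ 2) = p := by
  decide +kernel

theorem canonicalTest3_iff_forall_mem (A : Matrix (Fin 3) (Fin 3) ℕ) :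
    canonicalTest3 A = true ↔ ∀ p ∈ perms3, A p.1 p.1 = A 0 0 → A p.2.1 p.2.1 = A 1 1 →
      A p.2.2 p.2.2 = A 2 2 → permCode3 A 0 1 2 ≤ permCode3 A p.1 p.2.1 p.2.2 := by
  simp only [canonicalTest3, orderTest3, andThen_eq, impThen_eq, Nat.beq_eq, Nat.ble_eq, perms3,
    List.forall_mem_cons, List.not_mem_nil, false_imp_iff, implies_true, and_true]

theorem canonicalTest3_iff (A : Matrix (Fin 3) (Fin 3) ℕ) :
    canonicalTest3 A = true ↔ ∀ σ : Equiv.Perm (Fin 3), (∀ i, A (σ i) (σ i) = A i i) →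
      permCode3 A 0 1 2 ≤ permCode3 (A.submatrix σ σ) 0 1 2 := by
  simp only [permCode3_submatrix]
  rw [canonicalTest3_iff_forall_mem]
  constructor
  · intro H σ hσ
    exact H _ (mem_perms3 σ) (hσ 0) (hσ 1) (hσ 2)
  · intro H p hp h0 h1 h2
    obtain ⟨σ, rfl⟩ := exists_of_mem_perms3 p hp
    refine H σ fun i => ?_
    fin_cases i <;> assumption

/-- The sum over the rows of length three with sum `k`. -/
noncomputable def rowSum3 (k : ℕ) (f : ℕ → ℕ → ℕ → ℕ) : ℕ :=
  listSum (List.Nat.antidiagonalTuple 3 k) fun r =>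
    force (r 0) fun a => force (r 1) fun b => force (r 2) fun c => f a b c

/-- The number of canonical admissible matrices with three given rows: zero or one. -/
noncomputable def count3₃ (a00 a01 a02 a10 a11 a12 a20 a21 a22 : ℕ) : ℕ :=
  gate (Nat.ble a11 a22) <|
  gate (Nat.beq (Nat.mul (Nat.mul a01 a12) a20) (Nat.mul (Nat.mul a02 a21) a10)) <|
  gate (admissibleTest3 a01 a02 a10 a12 a20 a21) <|
  gate (canonicalTest3 !![a00, a01, a02; a10, a11, a12; a20, a21, a22]) 1

/-- The number of canonical admissible matrices with two given rows. -/
noncomputable def count3₂ (k a00 a01 a02 a10 a11 a12 : ℕ) : ℕ :=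
  gate (Nat.ble a00 a11) <| rowSum3 k <| count3₃ a00 a01 a02 a10 a11 a12

/-- The number of canonical admissible `3 × 3` matrices. -/
noncomputable def count3 (k : ℕ) : ℕ :=
  rowSum3 k fun a00 a01 a02 => rowSum3 k <| count3₂ k a00 a01 a02

theorem rowSum3_eq (k : ℕ) (f : ℕ → ℕ → ℕ → ℕ) : rowSum3 k f =
    ∑ r ∈ Finset.Nat.antidiagonalTuple 3 k, f (r 0) (r 1) (r 2) := by
  simp only [rowSum3, force_eq, listSum_antidiagonalTuple]

theorem isAdmissible_and_isCanonical3_iff {k : ℕ} {A : Matrix (Fin 3) (Fin 3) ℕ}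
    (hrow : ∀ i, ∑ j, A i j = k) :
    (IsAdmissible k A ∧ IsCanonical (fun A => permCode3 A 0 1 2) A) ↔
      A 0 0 ≤ A 1 1 ∧ A 1 1 ≤ A 2 2 ∧
      Nat.mul (Nat.mul (A 0 1) (A 1 2)) (A 2 0) = Nat.mul (Nat.mul (A 0 2) (A 2 1)) (A 1 0) ∧
      admissibleTest3 (A 0 1) (A 0 2) (A 1 0) (A 1 2) (A 2 0) (A 2 1) = true ∧
      canonicalTest3 A = true := by
  rw [admissibleTest3_iff, canonicalTest3_iff]
  constructor
  · rintro ⟨hA, hA'⟩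
    obtain ⟨w, hw, hbal⟩ := hA.balanced
    exact ⟨hA'.monotone (by decide : (0 : Fin 3) ≤ 1), hA'.monotone (by decide : (1 : Fin 3) ≤ 2),
      triangle_of_balanced (hw 0) (hw 1) (hw 2) (hbal 0 1) (hbal 1 2) (hbal 0 2),
      ⟨hA.balanced, hA.irreducible⟩, hA'.code_le⟩
  · rintro ⟨h01, h12, -, ⟨hbal, hirr⟩, hcode⟩
    refine ⟨⟨hrow, hbal, hirr⟩, ?_, hcode⟩
    rw [Fin.monotone_iff_le_succ]
    simp only [Fin.forall_fin_succ, IsEmpty.forall_iff, and_true]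
    exact ⟨h01, h12⟩

theorem ncard_eq_count3 (k : ℕ) :
    {A : Matrix (Fin 3) (Fin 3) ℕ | IsAdmissible k A ∧
      IsCanonical (fun A => permCode3 A 0 1 2) A}.ncard = count3 k := by
  classical
  rw [ncard_eq_sum (k := k) _ fun A h => h.1.row_sum]
  simp only [sum_piFinset_succ, sum_piFinset_zero]
  simp only [count3, count3₂, count3₃, rowSum3_eq, gate_eq, ite_sum, Nat.beq_eq, Nat.ble_eq]
  refine Finset.sum_congr rfl fun r0 h0 => Finset.sum_congr rfl fun r1 h1 =>
    Finset.sum_congr rfl fun r2 h2 => ?_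
  have he : !![r0 0, r0 1, r0 2; r1 0, r1 1, r1 2; r2 0, r2 1, r2 2] =
      Matrix.of ![r0, r1, r2] := by
    ext i j
    fin_cases i <;> fin_cases j <;> rfl
  rw [he]
  rw [Finset.Nat.mem_antidiagonalTuple] at h0 h1 h2
  have hiff := isAdmissible_and_isCanonical3_iff (k := k) (A := Matrix.of ![r0, r1, r2])
    (by simpa [Fin.forall_fin_succ] using ⟨h0, h1, h2⟩)
  simp only [← ite_and]
  split_ifs with hT hC hC
  · rfl
  · exact absurd (hiff.1 hT) hC
  · exact absurd (hiff.2 hC) hT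
  · rfl

theorem numColorAdjacencyMatrices_three {k : ℕ} (hk : k < 8) :
    numColorAdjacencyMatrices 3 k = count3 k := by
  rw [← ncard_eq_count3]
  exact numColorAdjacencyMatrices_eq_ncard _ fun A B hA hB h => permCode3_injective
    (fun i j => (hA i j).trans_lt hk) (fun i j => (hB i j).trans_lt hk) h

/-- The test for `A` and `B` not to be equivalent. -/
noncomputable def inequivTest3 (A B : Matrix (Fin 3) (Fin 3) ℕ) : Bool :=
  andThen (neTest (permCode3 B 0 1 2) (permCode3 A 0 1 2)) <|
  andThen (neTest (permCode3 B 0 1 2) (permCode3 A 0 2 1)) <|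
  andThen (neTest (permCode3 B 0 1 2) (permCode3 A 1 0 2)) <|
  andThen (neTest (permCode3 B 0 1 2) (permCode3 A 1 2 0)) <|
  andThen (neTest (permCode3 B 0 1 2) (permCode3 A 2 0 1)) <|
    neTest (permCode3 B 0 1 2) (permCode3 A 2 1 0)

theorem not_colorEquiv_of_inequivTest3 {A B : Matrix (Fin 3) (Fin 3) ℕ}
    (h : inequivTest3 A B = true) : ¬ ColorEquiv A B := by
  have h' : ∀ p ∈ perms3, permCode3 B 0 1 2 ≠ permCode3 A p.1 p.2.1 p.2.2 := by
    simpa only [inequivTest3, andThen_eq, neTest_eq, perms3, List.forall_mem_cons,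
      List.not_mem_nil, false_imp_iff, implies_true, and_true] using h
  rintro ⟨σ, rfl⟩
  exact h' _ (mem_perms3 σ) (permCode3_submatrix A σ 0 1 2)

theorem isCompleteList_of_tests3 {k : ℕ} {L : List (Matrix (Fin 3) (Fin 3) ℕ)} (hk : k < 8)
    (hL : L ≠ []) (hcard : count3 k = L.length)
    (hadm : ∀ A ∈ L, (∀ i, A i 0 + A i 1 + A i 2 = k) ∧
      admissibleTest3 (A 0 1) (A 0 2) (A 1 0) (A 1 2) (A 2 0) (A 2 1) = true)
    (hpw : pairwiseTest L inequivTest3 = true) : IsCompleteList k L := by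
  refine isCompleteList_of_length hL (fun A hA => ?_)
    (((pairwiseTest_eq _ _).1 hpw).imp fun h => not_colorEquiv_of_inequivTest3 h)
    ((numColorAdjacencyMatrices_three hk).trans hcard)
  obtain ⟨h1, h2⟩ := hadm A hA
  obtain ⟨hbal, hirr⟩ := (admissibleTest3_iff A).1 h2
  exact ⟨fun i => (Fin.sum_univ_three _).trans (h1 i), hbal, hirr⟩

theorem count3_three : count3 3 = 18 := Nat.eq_of_beq_eq_true (by decide +kernel)

theorem count3_four : count3 4 = 64 := Nat.eq_of_beq_eq_true (by decide +kernel)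

theorem count3_five : count3 5 = 153 := Nat.eq_of_beq_eq_true (by decide +kernel)

set_option maxRecDepth 100000 in
theorem isCompleteList_threeColorThreeRegular : IsCompleteList 3 threeColorThreeRegular :=
  isCompleteList_of_tests3 (by decide) (List.cons_ne_nil _ _) count3_three (by decide +kernel)
    (by decide +kernel)

set_option maxRecDepth 100000 in
theorem isCompleteList_threeColorFourRegular : IsCompleteList 4 threeColorFourRegular :=
  isCompleteList_of_tests3 (by decide) (List.cons_ne_nil _ _) count3_four (by decide +kernel)
    (by decide +kernel)

set_option maxRecDepth 100000 in
theorem isCompleteList_threeColorFiveRegular : IsCompleteList 5 threeColorFiveRegular :=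
  isCompleteList_of_tests3 (by decide) (List.cons_ne_nil _ _) count3_five (by decide +kernel)
    (by decide +kernel)

/-! ### Two colors -/

theorem isAdmissible_two_iff {k : ℕ} {A : Matrix (Fin 2) (Fin 2) ℕ} :
    IsAdmissible k A ↔ (∀ i, A i 0 + A i 1 = k) ∧ 0 < A 0 1 ∧ 0 < A 1 0 := by
  constructor
  · intro h
    obtain ⟨w, hw, hbal⟩ := h.balanced
    have hz : A 0 1 = 0 ↔ A 1 0 = 0 := eq_zero_iff_of_mul_eq (hw 0) (hw 1) (hbal 0 1)
    have h01 : A 0 1 ≠ 0 := fun h0 => by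
      have := h.irreducible ![true, false] (fun i j => ?_) 0 1
      · simp at this
      · fin_cases i <;> fin_cases j <;> simp [h0, hz.1 h0]
    exact ⟨fun i => (Fin.sum_univ_two _).symm.trans (h.row_sum i), Nat.pos_of_ne_zero h01,
      Nat.pos_of_ne_zero (hz.not.1 h01)⟩
  · rintro ⟨hrow, h01, h10⟩
    refine ⟨fun i => (Fin.sum_univ_two _).trans (hrow i), ⟨![A 1 0, A 0 1], ?_, ?_⟩, ?_⟩
    · simp [Fin.forall_fin_two, h01, h10]
    · simp [Fin.forall_fin_two, mul_comm]
    · intro f hf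
      have := hf 0 1 h01.ne'
      simp [Fin.forall_fin_two, this]

theorem isCompleteList_two {k : ℕ} {L : List (Matrix (Fin 2) (Fin 2) ℕ)}
    (hadm : ∀ A ∈ L, (∀ i, A i 0 + A i 1 = k) ∧ 0 < A 0 1 ∧ 0 < A 1 0)
    (hcomplete : ∀ x ∈ Finset.Icc 1 k, ∀ y ∈ Finset.Icc 1 k, ∃ B ∈ L,
      ∃ σ : Equiv.Perm (Fin 2), B = !![k - x, x; y, k - y].submatrix σ σ)
    (hpw : L.Pairwise fun A B => ¬ ∃ σ : Equiv.Perm (Fin 2), B = A.submatrix σ σ) :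
    IsCompleteList k L := by
  refine ⟨fun A hA => (isAdmissible_two_iff.2 (hadm A hA)).isColorAdjacencyMatrix,
    fun A hA => ?_, hpw⟩
  obtain ⟨hrow, h01, h10⟩ := isAdmissible_two_iff.1 (isColorAdjacencyMatrix_iff.1 hA)
  have h0 := hrow 0
  have h1 := hrow 1
  have hAeq : A = !![k - A 0 1, A 0 1; A 1 0, k - A 1 0] := by
    ext i j
    fin_cases i <;> fin_cases j <;> simp <;> omega
  obtain ⟨B, hB, σ, hσ⟩ := hcomplete (A 0 1) (Finset.mem_Icc.2 ⟨h01, by omega⟩) (A 1 0)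
    (Finset.mem_Icc.2 ⟨h10, by omega⟩)
  exact ⟨B, hB, σ, by rw [hσ, ← hAeq]⟩

theorem isCompleteList_twoColorThreeRegular : IsCompleteList 3 twoColorThreeRegular :=
  isCompleteList_two (by decide +kernel) (by decide +kernel) (by decide +kernel)

theorem isCompleteList_twoColorFourRegular : IsCompleteList 4 twoColorFourRegular :=
  isCompleteList_two (by decide +kernel) (by decide +kernel) (by decide +kernel)

theorem isCompleteList_twoColorFiveRegular : IsCompleteList 5 twoColorFiveRegular :=
  isCompleteList_two (by decide +kernel) (by decide +kernel) (by decide +kernel)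

end ColorMatrix

open ColorMatrix in
theorem mainTheorem3 :
    IsCompleteList 3 twoColorThreeRegular ∧
    IsCompleteList 4 twoColorFourRegular ∧
    IsCompleteList 5 twoColorFiveRegular ∧
    IsCompleteList 3 threeColorThreeRegular ∧
    IsCompleteList 4 threeColorFourRegular ∧
    IsCompleteList 5 threeColorFiveRegular ∧
    numColorAdjacencyMatrices 2 3 = 6 ∧
    numColorAdjacencyMatrices 2 4 = 10 ∧
    numColorAdjacencyMatrices 2 5 = 15 ∧
    numColorAdjacencyMatrices 3 3 = 18 ∧
    numColorAdjacencyMatrices 3 4 = 64 ∧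
    numColorAdjacencyMatrices 3 5 = 153 ∧
    numColorAdjacencyMatrices 4 3 = 72 ∧
    numColorAdjacencyMatrices 4 4 = 485 ∧
    numColorAdjacencyMatrices 4 5 = 2042 ∧
    numRowSumMatrices 2 3 = 16 ∧
    numRowSumMatrices 2 4 = 25 ∧
    numRowSumMatrices 2 5 = 36 ∧
    numRowSumMatrices 3 3 = 1000 ∧
    numRowSumMatrices 3 4 = 3375 ∧
    numRowSumMatrices 3 5 = 9261 ∧
    numRowSumMatrices 4 3 = 160000 ∧
    numRowSumMatrices 4 4 = 1500625 ∧
    numRowSumMatrices 4 5 = 9834496 := by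
  refine ⟨isCompleteList_twoColorThreeRegular, isCompleteList_twoColorFourRegular,
    isCompleteList_twoColorFiveRegular, isCompleteList_threeColorThreeRegular,
    isCompleteList_threeColorFourRegular, isCompleteList_threeColorFiveRegular,
    numColorAdjacencyMatrices_eq_length isCompleteList_twoColorThreeRegular,
    numColorAdjacencyMatrices_eq_length isCompleteList_twoColorFourRegular,
    numColorAdjacencyMatrices_eq_length isCompleteList_twoColorFiveRegular,
    (numColorAdjacencyMatrices_three (by decide)).trans count3_three,
    (numColorAdjacencyMatrices_three (by decide)).trans count3_four,
    (numColorAdjacencyMatrices_three (by decide)).trans count3_five,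
    (numColorAdjacencyMatrices_four (by decide)).trans count4_three,
    (numColorAdjacencyMatrices_four (by decide)).trans count4_four,
    (numColorAdjacencyMatrices_four (by decide)).trans count4_five, ?_⟩
  simp only [numRowSumMatrices_eq]
  decide +kernel
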